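/- **Theorem.** Let $t$ be a real number with $-1<t<1$. For a partition $\lambda$ (identified with its Young diagram) let $m_k(\lambda)$ be the number of parts of $\lambda$ equal to $k\ge1$, and let $n(\lambda)=\sum_{i\ge1}(i-1)\lambda_i$. Let $P_\lambda(\,;t)$ be the Hall–Littlewood symmetric functions with real coefficients, let $Q_\lambda(\,;t)=\prod_{i\ge1}\prod_{j=1}^{m_i(\lambda)}(1-t^j)\,P_\lambda(\,;t)$, and set $\widetilde Q_\lambda(\,;t)=(-1)^{n(\lambda)}Q_\lambda(\,;t)$. Let $p_2$ be the second power sum. For partitions $\mu,\lambda$ with $|\lambda|=|\mu|+2$ write $\mu\nearrow\!\nearrow\lambda$ if $\mu\subset\lambda$ and the two boxes of $\lambda\setminus\mu$ lie either in a single column or in two consecutive columns (columns are numbered from $1$). For every partition $\mu$ there is a unique finitely supported family of real numbers $\xi_{\lambda/\mu}(t)$, indexed by partitions $\lambda$, with $$(1-t^2)\,p_2\cdot\widetilde Q_\mu(\,;t)=\sum_\lambda \xi_{\lambda/\mu}(t)\,\widetilde Q_\lambda(\,;t),$$ and the following holds, where factors containing $m_0(\mu)$ are read with $m_0(\mu)=+\infty$,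 that is, $t^{m_{k-1}(\mu)}=t^{m_{k-1}(\mu)-1}=0$ for $k=1$. - $\xi_{\lambda/\mu}(t)=0$ unless $|\lambda|=|\mu|+2$ and $\mu\nearrow\!\nearrow\lambda$. - If $\mu\nearrow\!\nearrow\lambda$ and both boxes of $\lambda\setminus\mu$ lie in column $k$, then $\xi_{\lambda/\mu}(t)=(1-t^{m_{k-1}(\mu)})(1-t^{m_{k-1}(\mu)-1})$. - If $\mu\nearrow\!\nearrow\lambda$ and the boxes of $\lambda\setminus\mu$ lie in columns $k$ and $k+1$, then $\xi_{\lambda/\mu}(t)=(-t)^{m_k(\mu)}(1+t)(1-t^{m_{k-1}(\mu)})$. If moreover $-1<t<0$, then $\xi_{\lambda/\mu}(t)>0$ whenever $\mu\nearrow\!\nearrow\lambda$. -/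

import Mathlib

open Finset MvPolynomial

noncomputable section

namespace HallLittlewood

/-! ### The algebra of symmetric functions -/

/-- The specialization `x_{n+1} = 0`, from polynomials in `n + 1` variables to polynomials in
`n` variables. -/
def setLastZero (n : ℕ) : MvPolynomial (Fin (n + 1)) ℝ →ₐ[ℝ] MvPolynomial (Fin n) ℝ :=
  aeval (Fin.snoc (α := fun _ => MvPolynomial (Fin n) ℝ) X 0)

/-- The algebra `Sym` of symmetric functions with real coefficients, as an inverse limit: its
elements are the sequences `(f_n)` of symmetric polynomials `f_n` in `n` variables that are
compatible with the specializations `x_{n+1} = 0` and whose degrees are bounded. -/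
def Sym : Subalgebra ℝ (∀ n : ℕ, MvPolynomial (Fin n) ℝ) where
  carrier := {f | (∀ n, (f n).IsSymmetric) ∧ (∀ n, setLastZero n (f (n + 1)) = f n) ∧
    ∃ d : ℕ, ∀ n, (f n).totalDegree ≤ d}
  mul_mem' := by
    rintro f g ⟨hf, hf', d, hd⟩ ⟨hg, hg', e, he⟩
    refine ⟨fun n => (hf n).mul (hg n), fun n => ?_, d + e, fun n => ?_⟩
    · simp [hf', hg']
    · exact (totalDegree_mul _ _).trans (add_le_add (hd n) (he n))
  add_mem' := by
    rintro f g ⟨hf, hf', d, hd⟩ ⟨hg, hg', e, he⟩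
    refine ⟨fun n => (hf n).add (hg n), fun n => ?_, max d e, fun n => ?_⟩
    · simp [hf', hg']
    · exact (totalDegree_add _ _).trans (max_le_max (hd n) (he n))
  algebraMap_mem' := by
    intro r
    refine ⟨fun n => MvPolynomial.IsSymmetric.C r, fun n => ?_, 0, fun n => ?_⟩
    · exact (setLastZero n).commutes r
    · exact (totalDegree_C r).le

/-- The power sum `p_k = ∑ x_i ^ k`, for `k ≥ 1`. -/
def powerSum (k : ℕ+) : Sym :=
  ⟨fun n => psum (Fin n) ℝ k, fun n => psum_isSymmetric _ _ _, fun n => by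
    simp [setLastZero, psum, Fin.sum_univ_castSucc], k, fun n => by
    unfold psum
    exact totalDegree_finsetSum_le fun i _ => (totalDegree_X_pow i k).le⟩

/-! ### Partitions, identified with Young diagrams

The cells of a `YoungDiagram` are indexed from `0`: the cell `(i, j)` lies in the row with
number `i + 1` and the column with number `j + 1`. -/

/-- The length `ℓ(lam)`, the number of nonzero parts. -/
def len (lam : YoungDiagram) : ℕ := lam.colLen 0

/-- `m_k(lam)`, the number of parts (rows) equal to `k`, for `k ≥ 1`. -/
def mult (lam : YoungDiagram) (k : ℕ) : ℕ := lam.rowLens.count k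

/-- `n(lam) = ∑_{i ≥ 1} (i - 1) lam_i`. -/
def nStat (lam : YoungDiagram) : ℕ := ∑ i ∈ range (len lam), i * lam.rowLen i

/-- The set of the numbers (counted from `1`) of the columns that contain a box of
`lam ∖ mu`. -/
def skewColumns (mu lam : YoungDiagram) : Finset ℕ :=
  (lam.cells \ mu.cells).image fun c => c.2 + 1

/-- `lam` is obtained from `mu` by adding two boxes, both in the column with number `k`. -/
def AddsDominoAt (mu lam : YoungDiagram) (k : ℕ) : Prop :=
  mu ≤ lam ∧ lam.card = mu.card + 2 ∧ skewColumns mu lam = {k}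

/-- `lam` is obtained from `mu` by adding two boxes, one in the column with number `k` and one
in the column with number `k + 1`. -/
def AddsPairAt (mu lam : YoungDiagram) (k : ℕ) : Prop :=
  mu ≤ lam ∧ lam.card = mu.card + 2 ∧ skewColumns mu lam = {k, k + 1}

/-- The relation `mu ↗↗ lam`: `lam` is obtained from `mu` by adding two boxes which lie in a
single column or in two consecutive columns. -/
def UpUp (mu lam : YoungDiagram) : Prop :=
  ∃ k, AddsDominoAt mu lam k ∨ AddsPairAt mu lam k

/-! ### Hall-Littlewood polynomials in finitely many variables -/

/-- `∑_{w ∈ S_n} w (x_1 ^ a_1 ⋯ x_n ^ a_n ∏_{i < j} (x_i - t x_j) / (x_i - x_j))`. -/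
def symmSum {K : Type*} [Field K] {n : ℕ} (t : K) (a : Fin n → ℕ) (x : Fin n → K) : K :=
  ∑ w : Equiv.Perm (Fin n), (∏ i, x (w i) ^ a i) *
    ∏ i, ∏ j ∈ Ioi i, (x (w i) - t * x (w j)) / (x (w i) - x (w j))

/-- `v_m(t) = ∏_{i=1}^m (1 - t ^ i) / (1 - t)`. -/
def vNum (t : ℝ) (m : ℕ) : ℝ := ∏ i ∈ Icc 1 m, (1 - t ^ i) / (1 - t)

/-- `v_lam(t) = ∏_{i ≥ 0} v_{m_i}(t)`, where `lam` is viewed as a sequence of `n` nonnegative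
parts, so that `m_0 = n - ℓ(lam)`. -/
def vPart (t : ℝ) (n : ℕ) (lam : YoungDiagram) : ℝ :=
  vNum t (n - len lam) * ∏ i ∈ Icc 1 (lam.rowLen 0), vNum t (mult lam i)

/-- `b_lam(t) = ∏_{i ≥ 1} ∏_{j=1}^{m_i(lam)} (1 - t ^ j)`. -/
def bPart (t : ℝ) (lam : YoungDiagram) : ℝ :=
  ∏ i ∈ Icc 1 (lam.rowLen 0), ∏ j ∈ Icc 1 (mult lam i), (1 - t ^ j)

/-- The Hall-Littlewood polynomial `P_lam(x_1, …, x_n; t)` for `n ≥ ℓ(lam)`, as a rational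
function:
`v_lam(t)⁻¹ ∑_{w ∈ S_n} w (x ^ lam ∏_{i < j} (x_i - t x_j) / (x_i - x_j))`. -/
def ratP (t : ℝ) (n : ℕ) (lam : YoungDiagram) : FractionRing (MvPolynomial (Fin n) ℝ) :=
  algebraMap ℝ _ (vPart t n lam)⁻¹ *
    symmSum (algebraMap ℝ _ t) (fun i : Fin n => lam.rowLen i)
      (fun i : Fin n => algebraMap (MvPolynomial (Fin n) ℝ) _ (X i))

/-- The Vandermonde product. -/
def vdm (n : ℕ) : MvPolynomial (Fin n) ℝ := ∏ i, ∏ j ∈ Ioi i, (X i - X j)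

/-- The numerator of `symmSum` over the Vandermonde product. -/
def altSum {n : ℕ} (t : ℝ) (a : Fin n → ℕ) : MvPolynomial (Fin n) ℝ :=
  ∑ w : Equiv.Perm (Fin n), ((Equiv.Perm.sign w : ℤ) : MvPolynomial (Fin n) ℝ) *
    ((∏ i, X (w i) ^ a i) * ∏ i, ∏ j ∈ Ioi i, (X (w i) - C t * X (w j)))

theorem vdm_ne_zero (n : ℕ) : vdm n ≠ 0 := by
  unfold vdm
  refine prod_ne_zero_iff.2 fun i _ => prod_ne_zero_iff.2 fun j hj => ?_
  rw [sub_ne_zero]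
  exact fun h => (mem_Ioi.1 hj).ne (X_injective h)

theorem rename_vdm {n : ℕ} (s : Equiv.Perm (Fin n)) :
    rename s (vdm n) = ((Equiv.Perm.sign s : ℤ) : MvPolynomial (Fin n) ℝ) * vdm n := by
  unfold vdm
  rw [← Equiv.Perm.prod_Ioi_comp_eq_sign_mul_prod s
    (f := fun i j => (X i - X j : MvPolynomial (Fin n) ℝ)) (fun i j => by ring)]
  simp [map_prod]

theorem rename_altSum {n : ℕ} (t : ℝ) (a : Fin n → ℕ) (s : Equiv.Perm (Fin n)) :
    rename s (altSum t a) =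
      ((Equiv.Perm.sign s : ℤ) : MvPolynomial (Fin n) ℝ) * altSum t a := by
  unfold altSum
  rw [map_sum, mul_sum, ← Equiv.sum_comp (Equiv.mulLeft s)
    (fun w => ((Equiv.Perm.sign s : ℤ) : MvPolynomial (Fin n) ℝ) *
      (((Equiv.Perm.sign w : ℤ) : MvPolynomial (Fin n) ℝ) *
    ((∏ i, X (w i) ^ a i) * ∏ i, ∏ j ∈ Ioi i, (X (w i) - C t * X (w j)))))]
  refine sum_congr rfl fun w _ => ?_
  have h : ((Equiv.Perm.sign s : ℤ) : MvPolynomial (Fin n) ℝ) *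
      ((Equiv.Perm.sign s : ℤ) : MvPolynomial (Fin n) ℝ) = 1 := by
    rw [← Int.cast_mul, ← Units.val_mul, Int.units_mul_self]; simp
  simp only [map_mul, map_prod, map_pow, map_sub, rename_X, rename_C, map_intCast,
    Equiv.coe_mulLeft, Equiv.Perm.coe_mul, Function.comp_apply, 
    Units.val_mul, Int.cast_mul]
  rw [← mul_assoc, ← mul_assoc, ← mul_assoc, ← mul_assoc, h, one_mul]

theorem sub_dvd_altSum {n : ℕ} (t : ℝ) (a : Fin n → ℕ) {i j : Fin n} (hij : i ≠ j) :
    (X i - X j : MvPolynomial (Fin n) ℝ) ∣ altSum t a := by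
  have h1 : ∀ p : MvPolynomial (Fin n) ℝ, (X i - X j) ∣ p - rename (Equiv.swap i j) p := by
    intro p
    rw [← Ideal.mem_span_singleton, ← Ideal.Quotient.eq]
    have : (Ideal.Quotient.mkₐ ℝ (Ideal.span {(X i - X j : MvPolynomial (Fin n) ℝ)})) =
        (Ideal.Quotient.mkₐ ℝ (Ideal.span {(X i - X j : MvPolynomial (Fin n) ℝ)})).comp
          (rename (Equiv.swap i j)) := by
      refine MvPolynomial.algHom_ext fun k => ?_
      have e : (Ideal.Quotient.mk (Ideal.span {(X i - X j : MvPolynomial (Fin n) ℝ)})) (X i) =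
          (Ideal.Quotient.mk (Ideal.span {(X i - X j : MvPolynomial (Fin n) ℝ)})) (X j) := by
        rw [Ideal.Quotient.eq, Ideal.mem_span_singleton]
      by_cases hi : k = i
      · subst hi; simpa using e
      by_cases hj : k = j
      · subst hj; simpa using e.symm
      · simp [Equiv.swap_apply_of_ne_of_ne hi hj]
    exact DFunLike.congr_fun this p
  have h2 := h1 (altSum t a)
  rw [rename_altSum, Equiv.Perm.sign_swap hij] at h2
  have h3 : altSum t a = C (1 / 2 : ℝ) * (altSum t a -
      (((-1 : ℤˣ) : ℤ) : MvPolynomial (Fin n) ℝ) * altSum t a) := by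
    have : (C (1 / 2 : ℝ) : MvPolynomial (Fin n) ℝ) * 2 = 1 := by
      rw [← map_ofNat C 2, ← C_mul]; norm_num
    push_cast
    linear_combination (-altSum t a) * this
  rw [h3]
  exact h2.mul_left _

theorem irreducible_sub {n : ℕ} {i j : Fin n} (hij : i ≠ j) :
    Irreducible (X i - X j : MvPolynomial (Fin n) ℝ) := by
  have hc : coeff (Finsupp.single i 1) (X i - X j : MvPolynomial (Fin n) ℝ) = 1 := by
    rw [coeff_sub, coeff_X, coeff_X]
    rw [if_pos rfl, if_neg, sub_zero]
    simp [Finsupp.single_left_inj, hij.symm]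
  refine irreducible_of_totalDegree_eq_one (le_antisymm ?_ ?_) ?_
  · exact (totalDegree_sub _ _).trans (by simp)
  · have := le_totalDegree (p := (X i - X j : MvPolynomial (Fin n) ℝ))
      (s := Finsupp.single i 1) (by rw [mem_support_iff, hc]; exact one_ne_zero)
    simpa using this
  · intro x hx
    have := hx (Finsupp.single i 1)
    rw [hc] at this
    exact isUnit_of_dvd_one this

theorem vdm_dvd_altSum {n : ℕ} (t : ℝ) (a : Fin n → ℕ) : vdm n ∣ altSum t a := by
  unfold vdm
  rw [prod_sigma']
  refine Finset.prod_dvd_of_isRelPrime ?_ ?_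
  · rintro ⟨i, j⟩ h ⟨k, l⟩ h' hne
    have hij : i < j := by simpa using h
    have hkl : k < l := by simpa using h'
    refine ((irreducible_sub hij.ne).isRelPrime_iff_not_dvd).2 ?_
    rintro ⟨q, hq⟩
    have e := congrArg (aeval (fun m : Fin n => if m = i then (X j : MvPolynomial (Fin n) ℝ)
      else X m)) hq
    simp only [map_sub, map_mul, aeval_X, if_true, if_neg hij.ne', sub_self, zero_mul] at e
    rw [sub_eq_zero] at e
    apply hne
    split_ifs at e with h1 h2 h2
    · exact absurd (h1.trans h2.symm) hkl.ne
    · have := X_injective e; subst h1; subst this; rfl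
    · have := X_injective e; subst h2; subst this; exact absurd hij hkl.not_gt
    · exact absurd (X_injective e) hkl.ne
  · rintro ⟨i, j⟩ h
    exact sub_dvd_altSum t a (by simpa using h : i < j).ne

theorem symmSum_mul_vdm {K : Type*} [Field K] [Algebra ℝ K] {n : ℕ} (t : ℝ) (a : Fin n → ℕ)
    {x : Fin n → K} (hx : Function.Injective x) :
    symmSum (algebraMap ℝ K t) a x * aeval x (vdm n) = aeval x (altSum t a) := by
  unfold symmSum altSum
  rw [sum_mul, map_sum]
  refine sum_congr rfl fun w _ => ?_
  have hd : ∏ i, ∏ j ∈ Ioi i, (x (w i) - x (w j)) =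
      ((Equiv.Perm.sign w : ℤ) : K) * aeval x (vdm n) := by
    rw [Equiv.Perm.prod_Ioi_comp_eq_sign_mul_prod w (f := fun i j => x i - x j)
      (fun i j => by ring)]
    simp [vdm, map_prod]
  have h0 : ∏ i, ∏ j ∈ Ioi i, (x (w i) - x (w j)) ≠ 0 :=
    prod_ne_zero_iff.2 fun i _ => prod_ne_zero_iff.2 fun j hj => sub_ne_zero.2
      fun h => (mem_Ioi.1 hj).ne (w.injective (hx h))
  have h : ((Equiv.Perm.sign w : ℤ) : K) * ((Equiv.Perm.sign w : ℤ) : K) = 1 := by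
    rw [← Int.cast_mul, ← Units.val_mul, Int.units_mul_self]; simp
  have hv : aeval x (vdm n) = ((Equiv.Perm.sign w : ℤ) : K) *
      ∏ i, ∏ j ∈ Ioi i, (x (w i) - x (w j)) := by
    rw [hd, ← mul_assoc, h, one_mul]
  simp only [prod_div_distrib]
  rw [hv]
  simp only [map_mul, map_prod, map_pow, map_sub, aeval_X, aeval_C, map_intCast]
  field_simp

theorem injective_vars (n : ℕ) : Function.Injective
    (fun i : Fin n => algebraMap (MvPolynomial (Fin n) ℝ)
      (FractionRing (MvPolynomial (Fin n) ℝ)) (X i)) :=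
  (IsFractionRing.injective _ _).comp X_injective

theorem aeval_vars (n : ℕ) (p : MvPolynomial (Fin n) ℝ) :
    aeval (fun i : Fin n => algebraMap (MvPolynomial (Fin n) ℝ)
      (FractionRing (MvPolynomial (Fin n) ℝ)) (X i)) p = algebraMap _ _ p := by
  have : aeval (fun i : Fin n => algebraMap (MvPolynomial (Fin n) ℝ)
      (FractionRing (MvPolynomial (Fin n) ℝ)) (X i)) =
      IsScalarTower.toAlgHom ℝ (MvPolynomial (Fin n) ℝ) _ :=
    MvPolynomial.algHom_ext fun k => by simp
  rw [this]; rfl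

/-- The rational function `P_lam(x_1, …, x_n; t)` is a polynomial. -/
theorem exists_polyP (t : ℝ) (n : ℕ) (lam : YoungDiagram) :
    ∃ p : MvPolynomial (Fin n) ℝ, algebraMap _ _ p = ratP t n lam := by
  obtain ⟨q, hq⟩ := vdm_dvd_altSum t (fun i : Fin n => lam.rowLen i)
  refine ⟨C (vPart t n lam)⁻¹ * q, ?_⟩
  have h := symmSum_mul_vdm t (fun i : Fin n => lam.rowLen i) (injective_vars n)
  rw [aeval_vars, aeval_vars, hq, map_mul, mul_comm] at h
  have hv : algebraMap (MvPolynomial (Fin n) ℝ)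
      (FractionRing (MvPolynomial (Fin n) ℝ)) (vdm n) ≠ 0 := by
    rw [Ne, IsFractionRing.to_map_eq_zero_iff]
    exact vdm_ne_zero n
  rw [ratP, mul_left_cancel₀ hv h, map_mul]
  rfl

/-- The Hall-Littlewood polynomial `P_lam(x_1, …, x_n; t)`, which is `0` by convention when
`n < ℓ(lam)`. -/
def polyP (t : ℝ) (lam : YoungDiagram) (n : ℕ) : MvPolynomial (Fin n) ℝ :=
  if n < len lam then 0 else (exists_polyP t n lam).choose


theorem vdm_mul_choose (t : ℝ) (n : ℕ) (lam : YoungDiagram) :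
    vdm n * (exists_polyP t n lam).choose =
      C (vPart t n lam)⁻¹ * altSum t (fun i : Fin n => lam.rowLen i) := by
  apply IsFractionRing.injective (MvPolynomial (Fin n) ℝ) (FractionRing (MvPolynomial (Fin n) ℝ))
  rw [map_mul, (exists_polyP t n lam).choose_spec, map_mul, ratP, ← aeval_vars n (altSum _ _),
    ← symmSum_mul_vdm _ _ (injective_vars n), aeval_vars, mul_left_comm, mul_comm (algebraMap _ _ (vdm n))]
  rfl

/-- Evaluation of the Hall-Littlewood polynomial at distinct points of a field. -/
theorem aeval_choose {K : Type*} [Field K] [Algebra ℝ K] (t : ℝ) (n : ℕ) (lam : YoungDiagram)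
    {x : Fin n → K} (hx : Function.Injective x) :
    aeval x (exists_polyP t n lam).choose = algebraMap ℝ K (vPart t n lam)⁻¹ *
      symmSum (algebraMap ℝ K t) (fun i : Fin n => lam.rowLen i) x := by
  have h := congrArg (aeval x) (vdm_mul_choose t n lam)
  rw [map_mul, map_mul, ← symmSum_mul_vdm _ _ hx, aeval_C] at h
  have h0 : aeval x (vdm n) ≠ 0 := by
    simp only [vdm, map_prod, map_sub, aeval_X]
    exact prod_ne_zero_iff.2 fun i _ => prod_ne_zero_iff.2 fun j hj => sub_ne_zero.2
      fun h => (mem_Ioi.1 hj).ne (hx h)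
  apply mul_left_cancel₀ h0
  rw [h]; ring

/-- The permutation sending `p` to the last element, and acting as `s` on the rest. -/
def extPerm {n : ℕ} (p : Fin (n + 1)) (s : Equiv.Perm (Fin n)) : Equiv.Perm (Fin (n + 1)) :=
  ((finSuccEquiv' p).trans (Equiv.optionCongr s)).trans (finSuccEquiv' (Fin.last n)).symm

theorem extPerm_self {n : ℕ} (p : Fin (n + 1)) (s : Equiv.Perm (Fin n)) :
    extPerm p s p = Fin.last n := by simp [extPerm]

theorem extPerm_succAbove {n : ℕ} (p : Fin (n + 1)) (s : Equiv.Perm (Fin n)) (k : Fin n) :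
    extPerm p s (p.succAbove k) = (s k).castSucc := by simp [extPerm]

theorem extPerm_bijective (n : ℕ) : Function.Bijective
    (fun q : Fin (n + 1) × Equiv.Perm (Fin n) => extPerm q.1 q.2) := by
  rw [Fintype.bijective_iff_injective_and_card]
  constructor
  · rintro ⟨p, s⟩ ⟨p', s'⟩ h
    have h : extPerm p s = extPerm p' s' := h
    have hp : p = p' := by
      apply (extPerm p s).injective
      rw [extPerm_self, h, extPerm_self]
    subst hp
    have : s = s' := by
      ext k
      have := congrArg (fun e => e (p.succAbove k)) h
      simp only [extPerm_succAbove] at this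
      exact congrArg Fin.val (Fin.castSucc_injective _ this)
    rw [this]
  · simp [Fintype.card_perm, Nat.factorial_succ]

theorem card_lt_succAbove {n : ℕ} (p : Fin (n + 1)) :
    (univ.filter fun k : Fin n => p < p.succAbove k).card = n - p := by
  have : (univ.filter fun k : Fin n => p < p.succAbove k) =
      univ.filter fun k : Fin n => (p : ℕ) ≤ k := by
    ext k
    simp [Fin.lt_succAbove_iff_le_castSucc, Fin.le_def]
  rw [this]
  have h2 : (univ.filter fun k : Fin n => (p : ℕ) ≤ k).card +
      (univ.filter fun k : Fin n => ¬ (p : ℕ) ≤ k).card = n := by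
    rw [card_filter_add_card_filter_not]; simp
  have h3 : (univ.filter fun k : Fin n => ¬ (p : ℕ) ≤ k).card = p := by
    simp only [not_le]
    rw [Fin.card_filter_val_lt]
    have := p.2
    omega
  omega

theorem symmSum_snoc {K : Type*} [Field K] {n : ℕ} (t : K) (a : Fin (n + 1) → ℕ)
    (x : Fin n → K) (h0 : ∀ i, x i ≠ 0) :
    symmSum t a (Fin.snoc (α := fun _ => K) x 0) =
      ∑ p : Fin (n + 1), 0 ^ a p * t ^ (n - p) * symmSum t (fun k => a (p.succAbove k)) x := by
  unfold symmSum
  rw [← (extPerm_bijective n).sum_comp, Fintype.sum_prod_type]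
  refine sum_congr rfl fun p _ => ?_
  rw [mul_sum]
  refine sum_congr rfl fun s _ => ?_
  have key : ∀ {m : ℕ} (f : Fin m → Fin m → K), ∏ i, ∏ j ∈ Ioi i, f i j =
      ∏ i, ∏ j, if i < j then f i j else 1 := by
    intro m f
    refine prod_congr rfl fun i _ => ?_
    rw [← prod_filter]
    congr 1
    ext j; simp
  rw [key, key, Fin.prod_univ_succAbove _ p, Fin.prod_univ_succAbove _ p,
    Fin.prod_univ_succAbove _ p]
  simp only [Fin.prod_univ_succAbove _ p, extPerm_self, extPerm_succAbove, Fin.snoc_last,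
    Fin.snoc_castSucc, lt_irrefl, if_false, one_mul, Fin.succAbove_lt_succAbove_iff, mul_zero,
    sub_zero, zero_sub]
  have e1 : ∀ k, (if p < p.succAbove k then -(t * x (s k)) / -x (s k) else 1) =
      if p < p.succAbove k then t else 1 := by
    intro k
    have := h0 (s k)
    split_ifs
    · field_simp
    · rfl
  have e2 : ∀ k, (if p.succAbove k < p then x (s k) / x (s k) else 1) = 1 := by
    intro k
    rw [div_self (h0 _), ite_self]
  simp only [e1, e2, one_mul]
  rw [← prod_filter, prod_const, card_lt_succAbove]
  ring

theorem len_le_iff {lam : YoungDiagram} {i : ℕ} : len lam ≤ i ↔ lam.rowLen i = 0 := by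
  unfold len
  rw [← not_lt, ← YoungDiagram.mem_iff_lt_colLen, YoungDiagram.mem_iff_lt_rowLen, not_lt,
    Nat.le_zero]

theorem one_sub_pow_ne {t : ℝ} (ht : t ∈ Set.Ioo (-1 : ℝ) 1) {i : ℕ} (hi : 1 ≤ i) :
    1 - t ^ i ≠ 0 := by
  have : |t ^ i| < 1 := by
    rw [abs_pow]
    exact pow_lt_one₀ (abs_nonneg t) (abs_lt.2 ht) (by omega)
  have := (abs_lt.1 this).2
  linarith

theorem vNum_ne_zero {t : ℝ} (ht : t ∈ Set.Ioo (-1 : ℝ) 1) (m : ℕ) : vNum t m ≠ 0 := by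
  unfold vNum
  refine prod_ne_zero_iff.2 fun i hi => div_ne_zero (one_sub_pow_ne ht (mem_Icc.1 hi).1) ?_
  simpa using one_sub_pow_ne ht le_rfl

theorem vPart_ne_zero {t : ℝ} (ht : t ∈ Set.Ioo (-1 : ℝ) 1) (n : ℕ) (lam : YoungDiagram) :
    vPart t n lam ≠ 0 :=
  mul_ne_zero (vNum_ne_zero ht _) (prod_ne_zero_iff.2 fun _ _ => vNum_ne_zero ht _)

theorem setLastZero_polyP {t : ℝ} (ht : t ∈ Set.Ioo (-1 : ℝ) 1) (lam : YoungDiagram) (n : ℕ) :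
    setLastZero n (polyP t lam (n + 1)) = polyP t lam n := by
  unfold polyP
  by_cases h1 : n + 1 < len lam
  · rw [if_pos h1, if_pos (by omega), map_zero]
  rw [if_neg h1]
  set x : Fin n → FractionRing (MvPolynomial (Fin n) ℝ) :=
    fun i => algebraMap (MvPolynomial (Fin n) ℝ) _ (X i) with hx
  have hx0 : ∀ i, x i ≠ 0 := fun i => by
    simp [hx]
  have hinj : Function.Injective (Fin.snoc (α := fun _ => FractionRing (MvPolynomial (Fin n) ℝ))
      x 0) := by
    rw [Fin.snoc_injective_iff]
    refine ⟨injective_vars n, ?_⟩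
    rintro ⟨i, hi⟩
    exact hx0 i hi
  apply IsFractionRing.injective (MvPolynomial (Fin n) ℝ) (FractionRing (MvPolynomial (Fin n) ℝ))
  have e : ∀ p, algebraMap (MvPolynomial (Fin n) ℝ) (FractionRing (MvPolynomial (Fin n) ℝ))
      (setLastZero n p) = aeval (Fin.snoc (α := fun _ => FractionRing (MvPolynomial (Fin n) ℝ))
        x 0) p := by
    intro p
    have : (IsScalarTower.toAlgHom ℝ (MvPolynomial (Fin n) ℝ)
        (FractionRing (MvPolynomial (Fin n) ℝ))).comp (setLastZero n) =
        aeval (Fin.snoc (α := fun _ => FractionRing (MvPolynomial (Fin n) ℝ)) x 0) := by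
      refine MvPolynomial.algHom_ext fun k => ?_
      refine Fin.lastCases ?_ (fun i => ?_) k
      · simp [setLastZero]
      · simp [setLastZero, hx]
    exact DFunLike.congr_fun this p
  rw [e, aeval_choose t (n + 1) lam hinj, symmSum_snoc _ _ _ hx0]
  have hp : ∀ p : Fin (n + 1), len lam ≤ p → ∀ k : Fin n,
      lam.rowLen (p.succAbove k) = lam.rowLen k := by
    intro p hp k
    rcases lt_or_ge k.castSucc p with h | h
    · rw [Fin.succAbove_of_castSucc_lt _ _ h]; rfl
    · rw [Fin.succAbove_of_le_castSucc _ _ h]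
      have h : (p : ℕ) ≤ k := h
      rw [len_le_iff.1 (show len lam ≤ (k.succ : Fin (n + 1)) by simp; omega),
        len_le_iff.1 (hp.trans h)]
  by_cases h2 : n < len lam
  · rw [if_pos h2, map_zero, sum_eq_zero, mul_zero]
    intro p _
    rw [zero_pow, zero_mul, zero_mul]
    rw [Ne, ← len_le_iff]
    have := p.2
    omega
  rw [if_neg h2, (exists_polyP t n lam).choose_spec, ratP]
  have hs : ∑ p : Fin (n + 1), (0 : FractionRing (MvPolynomial (Fin n) ℝ)) ^ lam.rowLen p *
      algebraMap ℝ _ t ^ (n - (p : ℕ)) *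
      symmSum (algebraMap ℝ _ t) (fun k => lam.rowLen (p.succAbove k)) x =
      algebraMap ℝ _ (∑ i ∈ range (n + 1 - len lam), t ^ i) *
        symmSum (algebraMap ℝ _ t) (fun k : Fin n => lam.rowLen k) x := by
    rw [map_sum, sum_mul]
    have : ∀ p : Fin (n + 1), (0 : FractionRing (MvPolynomial (Fin n) ℝ)) ^ lam.rowLen p *
      algebraMap ℝ _ t ^ (n - (p : ℕ)) *
      symmSum (algebraMap ℝ _ t) (fun k => lam.rowLen (p.succAbove k)) x =
      (fun i : ℕ => if len lam ≤ i then algebraMap ℝ _ (t ^ (n - i)) *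
        symmSum (algebraMap ℝ _ t) (fun k : Fin n => lam.rowLen k) x else 0) p := by
      intro p
      by_cases h : len lam ≤ p
      · simp only [hp p h, len_le_iff.1 h, if_pos h, map_pow, pow_zero, one_mul]
      · simp only [if_neg h]
        rw [zero_pow, zero_mul, zero_mul]
        rwa [Ne, ← len_le_iff]
    rw [sum_congr rfl fun p _ => this p, Fin.sum_univ_eq_sum_range (fun i : ℕ =>
      if len lam ≤ i then algebraMap ℝ _ (t ^ (n - i)) *
        symmSum (algebraMap ℝ (FractionRing (MvPolynomial (Fin n) ℝ)) t)
          (fun k : Fin n => lam.rowLen k) x else 0),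
      ← sum_range_reflect, ← sum_filter]
    symm
    apply sum_subset_zero_on_sdiff
    · intro i hi
      simp only [mem_range] at hi
      simp only [mem_filter, mem_range]
      omega
    · intro i hi
      simp only [mem_sdiff, mem_filter, mem_range] at hi
      omega
    · intro i hi
      simp only [mem_range] at hi
      rw [show n - (n + 1 - 1 - i) = i by omega]
  rw [hs, ← mul_assoc, ← map_mul]
  congr 2
  have hv : vPart t (n + 1) lam = (∑ i ∈ range (n + 1 - len lam), t ^ i) * vPart t n lam := by
    unfold vPart
    rw [← mul_assoc]
    congr 1
    rw [show n + 1 - len lam = n - len lam + 1 by omega, vNum, Finset.prod_Icc_succ_top (by omega),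
      mul_comm, vNum]
    congr 1
    have h1t : t - 1 ≠ 0 := by
      have := ht.2
      linarith
    have h1t' : 1 - t ≠ 0 := by
      have := ht.2
      linarith
    rw [geom_sum_eq (by linarith [ht.2] : t ≠ 1)]
    field_simp
    ring
  have h3 := vPart_ne_zero ht (n + 1) lam
  have h4 := vPart_ne_zero ht n lam
  rw [inv_mul_eq_iff_eq_mul₀ h3, hv, mul_assoc, mul_inv_cancel₀ h4, mul_one]

theorem polyP_symmetric (t : ℝ) (lam : YoungDiagram) (n : ℕ) :
    (polyP t lam n).IsSymmetric := by
  unfold polyP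
  split_ifs
  · exact MvPolynomial.IsSymmetric.zero
  intro s
  have h := vdm_mul_choose t n lam
  have h' := congrArg (rename s) h
  rw [map_mul, map_mul, rename_vdm, rename_altSum, rename_C, mul_left_comm, ← h, mul_assoc] at h'
  have hs : ((Equiv.Perm.sign s : ℤ) : MvPolynomial (Fin n) ℝ) ≠ 0 := by
    rw [Int.cast_ne_zero]
    exact Units.ne_zero _
  exact mul_left_cancel₀ (vdm_ne_zero n) (mul_left_cancel₀ hs h')

theorem vdm_homogeneous (n : ℕ) :
    (vdm n).IsHomogeneous (∑ i : Fin n, ∑ _j ∈ Ioi i, 1) := by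
  refine IsHomogeneous.prod _ _ _ fun i _ => IsHomogeneous.prod _ _ _ fun j _ => ?_
  exact (isHomogeneous_X _ _).sub (isHomogeneous_X _ _)

theorem altSum_homogeneous {n : ℕ} (t : ℝ) (a : Fin n → ℕ) :
    (altSum t a).IsHomogeneous ((∑ i, a i) + ∑ i : Fin n, ∑ _j ∈ Ioi i, 1) := by
  refine IsHomogeneous.sum _ _ _ fun w _ => ?_
  rw [← map_intCast (C : ℝ →+* MvPolynomial (Fin n) ℝ)]
  refine IsHomogeneous.C_mul (IsHomogeneous.mul ?_ ?_) _
  · refine IsHomogeneous.prod _ _ _ fun i _ => ?_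
    simpa using (isHomogeneous_X ℝ (w i)).pow (a i)
  · refine IsHomogeneous.prod _ _ _ fun i _ => IsHomogeneous.prod _ _ _ fun j _ => ?_
    exact (isHomogeneous_X _ _).sub ((isHomogeneous_X _ _).C_mul t)

theorem sum_rowLen_le (lam : YoungDiagram) (n : ℕ) :
    ∑ i : Fin n, lam.rowLen i ≤ lam.card := by
  rw [Fin.sum_univ_eq_sum_range (fun i => lam.rowLen i)]
  simp only [YoungDiagram.rowLen_eq_card]
  rw [← card_biUnion]
  · refine card_le_card fun c hc => ?_
    simp only [mem_biUnion, YoungDiagram.mem_row_iff] at hc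
    obtain ⟨_, _, h, _⟩ := hc
    exact h
  · intro i _ j _ hij
    rw [Function.onFun, disjoint_left]
    intro c hc hc'
    rw [YoungDiagram.mem_row_iff] at hc hc'
    exact hij (hc.2.symm.trans hc'.2)

theorem totalDegree_polyP (t : ℝ) (lam : YoungDiagram) (n : ℕ) :
    (polyP t lam n).totalDegree ≤ lam.card := by
  unfold polyP
  split_ifs
  · simp
  set p := (exists_polyP t n lam).choose with hp
  by_cases h0 : p = 0
  · simp [h0]
  have h := vdm_mul_choose t n lam
  rw [← hp] at h
  have h1 := congrArg totalDegree h
  rw [totalDegree_mul_of_isDomain (vdm_ne_zero n) h0, (vdm_homogeneous n).totalDegree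
    (vdm_ne_zero n)] at h1
  have h2 := ((altSum_homogeneous t (fun i : Fin n => lam.rowLen i)).C_mul
    (vPart t n lam)⁻¹).totalDegree_le
  have h3 := sum_rowLen_le lam n
  omega

/-! ### Hall-Littlewood functions -/

/-- The Hall-Littlewood function `P_lam(; t)`, with parameter `t ∈ (-1, 1)`. -/
def hlP {t : ℝ} (ht : t ∈ Set.Ioo (-1 : ℝ) 1) (lam : YoungDiagram) : Sym :=
  ⟨polyP t lam, polyP_symmetric t lam, setLastZero_polyP ht lam, lam.card,
    totalDegree_polyP t lam⟩

/-- The Hall-Littlewood function `Q_lam(; t) = b_lam(t) P_lam(; t)`. -/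
def hlQ {t : ℝ} (ht : t ∈ Set.Ioo (-1 : ℝ) 1) (lam : YoungDiagram) : Sym :=
  bPart t lam • hlP ht lam

/-- The modified function `(-1)^{n(lam)} Q_lam(; t)`. -/
def hlQtilde {t : ℝ} (ht : t ∈ Set.Ioo (-1 : ℝ) 1) (lam : YoungDiagram) : Sym :=
  (-1 : ℝ) ^ nStat lam • hlQ ht lam

end HallLittlewood

end

open HallLittlewood

open HallLittlewood

/-! In n variables, multiplication by the Vandermonde product turns Q̃_λ into a scalar times R(λ),
where R(a) is the antisymmetrization of x^a ∏_{k<l} (x_k - t x_l) (`vdm_mul_hlQtilde`). Since p_2 is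
symmetric, p_2 R(μ) = ∑_i R(μ + 2e_i), and it remains to straighten the exponents that are not
partitions.

Straightening rests on one fact: (x_{i+1} - t x_i) ∏_{k<l} (x_k - t x_l) is invariant under the
exchange of x_i and x_{i+1}, so its product with anything equally invariant antisymmetrizes to 0
(`alternation_adjacent`). Iterated over a block of m equal rows starting at s, this collapses (1 -
t^2) ∑ R(a + 2e_i) to (1 + t)(1 - t^m) R(a + 2e_s) - (1 - t^m)(1 - t^{m-1}) R(a + e_s + e_{s+1})
(`sum_seqAlt_block`). If these rows have length c, the second term is the domino in column c + 1. In
the first, one unit still has to climb past the m_{c+1} rows of length c + 1, at the cost of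
t^{m_{c+1}}; this gives the pair in columns c + 1 and c + 2. The signs (-1)^{n(λ)} turn the minus
into a plus and this t into -t.

For the block of n - ℓ(μ) empty rows, the factors 1 - t^{n-ℓ(μ)} and 1 - t^{n-ℓ(μ)-1} are absorbed
by the change of normalization between μ and λ; this is the convention m_0 = +∞. An identity valid
for all large n holds for symmetric functions (`eq_of_restrict_eq`).

Uniqueness is linear independence: setting the last of n variables to 0 kills exactly the diagrams
of length n, and for those the product of the variables factors out, which removes the first column
(`polyP_independent`). -/

namespace HallLittlewood

/-! ### Antisymmetrization and the t-Vandermonde product -/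

/-- The product `∏_{i < j} (x_i - t x_j)`. -/
noncomputable def tVdm (t : ℝ) (n : ℕ) : MvPolynomial (Fin n) ℝ :=
  ∏ i, ∏ j ∈ Ioi i, (X i - C t * X j)

/-- The alternating sum `∑_w sign(w) w(p)`. -/
noncomputable def alternation {n : ℕ} (p : MvPolynomial (Fin n) ℝ) : MvPolynomial (Fin n) ℝ :=
  ∑ w : Equiv.Perm (Fin n), ((Equiv.Perm.sign w : ℤ) : MvPolynomial (Fin n) ℝ) * rename w p

theorem altSum_eq_alternation {n : ℕ} (t : ℝ) (a : Fin n → ℕ) :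
    altSum t a = alternation ((∏ i, X i ^ a i) * tVdm t n) := by
  unfold altSum alternation tVdm
  simp [map_prod]

theorem alternation_add {n : ℕ} (p q : MvPolynomial (Fin n) ℝ) :
    alternation (p + q) = alternation p + alternation q := by
  simp [alternation, mul_add, sum_add_distrib]

theorem alternation_C_mul {n : ℕ} (r : ℝ) (p : MvPolynomial (Fin n) ℝ) :
    alternation (C r * p) = C r * alternation p := by
  simp [alternation, mul_sum, mul_left_comm]

/-- The terms of w and of w composed with the transposition are opposite, so the sum cancels in
pairs. -/
theorem alternation_eq_zero {n : ℕ} {i j : Fin n} (hij : i ≠ j) {p : MvPolynomial (Fin n) ℝ}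
    (h : rename (Equiv.swap i j) p = p) : alternation p = 0 := by
  unfold alternation
  refine sum_involution (fun w _ => w * Equiv.swap i j) ?_ ?_ (fun _ _ => mem_univ _) ?_
  · intro w _
    have : rename (⇑(w * Equiv.swap i j)) p = rename w p := by
      conv_rhs => rw [← h]
      rw [rename_rename]; rfl
    rw [this, Equiv.Perm.sign_mul, Equiv.Perm.sign_swap hij]
    simp
  · intro w _ _ hw
    have := congrArg (fun e => e i) (mul_eq_left.1 hw)
    simp at this
    exact hij this.symm
  · intro w _
    simp [mul_assoc]

/-- An adjacent transposition has exactly one inversion. -/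
theorem swap_lt_swap {n : ℕ} {i j p q : Fin n} (hij : (j : ℕ) = i + 1) (hpq : p < q)
    (hne : (p, q) ≠ (i, j)) : Equiv.swap i j p < Equiv.swap i j q := by
  rw [Ne, Prod.mk.injEq] at hne
  simp only [Equiv.swap_apply_def]
  simp only [Fin.ext_iff, Fin.lt_def] at *
  split_ifs <;> omega

/-- The adjacent transposition permutes all factors except that of the pair (i, j). The
cross-multiplied form avoids a quotient. -/
theorem rename_swap_tVdm {n : ℕ} (t : ℝ) {i j : Fin n} (hij : (j : ℕ) = i + 1) :
    rename (Equiv.swap i j) (tVdm t n) * (X i - C t * X j) =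
      tVdm t n * (X j - C t * X i) := by
  have hlt : i < j := by rw [Fin.lt_def]; omega
  have e : tVdm t n = ∏ x ∈ (univ : Finset (Fin n × Fin n)).filter (fun x => x.1 < x.2),
      (X x.1 - C t * X x.2) := by
    rw [tVdm, prod_filter, Fintype.prod_prod_type]
    refine prod_congr rfl fun i _ => ?_
    rw [← prod_filter]
    congr 1
    ext j; simp
  have hm : (i, j) ∈ (univ : Finset (Fin n × Fin n)).filter (fun x => x.1 < x.2) := by simp [hlt]
  rw [e, ← mul_prod_erase _ _ hm, map_mul, map_prod]
  have : ∏ x ∈ ((univ : Finset (Fin n × Fin n)).filter (fun x => x.1 < x.2)).erase (i, j),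
      rename (Equiv.swap i j) (X x.1 - C t * X x.2 : MvPolynomial (Fin n) ℝ) =
      ∏ x ∈ ((univ : Finset (Fin n × Fin n)).filter (fun x => x.1 < x.2)).erase (i, j),
      (X x.1 - C t * X x.2) := by
    have hs : ∀ x ∈ ((univ : Finset (Fin n × Fin n)).filter (fun x => x.1 < x.2)).erase (i, j),
        (Equiv.swap i j x.1, Equiv.swap i j x.2) ∈
        ((univ : Finset (Fin n × Fin n)).filter (fun x => x.1 < x.2)).erase (i, j) := by
      rintro ⟨p, q⟩ hx
      rw [mem_erase, mem_filter] at hx ⊢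
      refine ⟨?_, mem_univ _, swap_lt_swap hij hx.2.2 hx.1⟩
      intro h
      rw [Prod.mk.injEq, Equiv.swap_apply_eq_iff, Equiv.swap_apply_eq_iff, Equiv.swap_apply_left,
        Equiv.swap_apply_right] at h
      obtain ⟨rfl, rfl⟩ := h
      exact absurd hx.2.2 hlt.not_gt
    refine prod_bij' (fun x _ => (Equiv.swap i j x.1, Equiv.swap i j x.2))
      (fun x _ => (Equiv.swap i j x.1, Equiv.swap i j x.2)) hs hs ?_ ?_ ?_
    · intro x _; simp
    · intro x _; simp
    · intro x _; simp
  rw [this]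
  simp
  ring

/-- The alternation of a multiple of `∏_{i < j} (x_i - t x_j)` vanishes when the cofactor
divided by `x_j - t x_i`, with `i, j` adjacent, is symmetric in `x_i, x_j`. -/
theorem alternation_adjacent {n : ℕ} (t : ℝ) {i j : Fin n} (hij : (j : ℕ) = i + 1)
    {p : MvPolynomial (Fin n) ℝ} (h : rename (Equiv.swap i j) p = p) :
    alternation (p * (X j - C t * X i) * tVdm t n) = 0 := by
  have hne : i ≠ j := by intro h; subst h; omega
  refine alternation_eq_zero hne ?_
  rw [map_mul, map_mul, h]
  simp only [map_sub, map_mul, rename_X, rename_C, Equiv.swap_apply_left, Equiv.swap_apply_right]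
  linear_combination p * rename_swap_tVdm t hij

/-! ### Straightening of exponents -/

/-- `altSum` for the first `n` terms of a sequence of exponents. -/
noncomputable def seqAlt (t : ℝ) (n : ℕ) (a : ℕ → ℕ) : MvPolynomial (Fin n) ℝ :=
  altSum t (fun i : Fin n => a i)

/-- The monomial whose exponents are the first `n` terms of a sequence. -/
noncomputable def seqMon (n : ℕ) (a : ℕ → ℕ) : MvPolynomial (Fin n) ℝ := ∏ i : Fin n, X i ^ a i

theorem seqMon_add_single {n : ℕ} (a : ℕ → ℕ) (p : Fin n) :
    seqMon n (a + Pi.single (p : ℕ) 1) = seqMon n a * X p := by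
  unfold seqMon
  simp only [Pi.add_apply, pow_add, prod_mul_distrib]
  congr 1
  rw [prod_eq_single p]
  · simp
  · intro b _ hb
    rw [Pi.single_eq_of_ne (fun h => hb (Fin.ext h)), pow_zero]
  · simp

theorem rename_seqMon {n : ℕ} {a : ℕ → ℕ} {i j : Fin n} (h : a i = a j) :
    rename (Equiv.swap i j) (seqMon n a) = seqMon n a := by
  unfold seqMon
  rw [map_prod, ← Equiv.prod_comp (Equiv.swap i j) (fun k => (X k : MvPolynomial (Fin n) ℝ) ^ a k)]
  refine prod_congr rfl fun k _ => ?_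
  rw [map_pow, rename_X]
  congr 1
  rw [Equiv.swap_apply_def]
  split_ifs with h1 h2
  · rw [h1, h]
  · rw [h2, h]
  · rfl

theorem seqAlt_eq (t : ℝ) (n : ℕ) (a : ℕ → ℕ) :
    seqAlt t n a = alternation (seqMon n a * tVdm t n) := altSum_eq_alternation _ _

/-- This is `alternation_adjacent` with the invariant cofactor x^b. -/
theorem seqAlt_move {t : ℝ} {n p : ℕ} (hp : p + 1 < n) {b : ℕ → ℕ} (hb : b p = b (p + 1)) :
    seqAlt t n (b + Pi.single (p + 1) 1) = C t * seqAlt t n (b + Pi.single p 1) := by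
  have h := alternation_adjacent t (i := ⟨p, by omega⟩) (j := ⟨p + 1, hp⟩) rfl
    (p := seqMon n b) (rename_seqMon hb)
  have h1 := seqMon_add_single b (⟨p, by omega⟩ : Fin n)
  have h2 := seqMon_add_single b (⟨p + 1, hp⟩ : Fin n)
  simp only at h1 h2
  rw [seqAlt_eq, seqAlt_eq, h1, h2, ← sub_eq_zero, ← h, sub_eq_add_neg, ← neg_mul, ← C_neg,
    ← alternation_C_mul, ← alternation_add, C_neg]
  congr 1
  ring

/-- The invariant cofactor is now x^b (x_p + x_{p+1}): expand (x_p + x_{p+1})(x_{p+1} - t x_p) =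
x_{p+1}^2 + (1 - t) x_p x_{p+1} - t x_p^2. -/
theorem seqAlt_move_two {t : ℝ} {n p : ℕ} (hp : p + 1 < n) {b : ℕ → ℕ} (hb : b p = b (p + 1)) :
    seqAlt t n (b + Pi.single (p + 1) 1 + Pi.single (p + 1) 1) =
      C t * seqAlt t n (b + Pi.single p 1 + Pi.single p 1) +
      C (t - 1) * seqAlt t n (b + Pi.single p 1 + Pi.single (p + 1) 1) := by
  have h := alternation_adjacent t (i := ⟨p, by omega⟩) (j := ⟨p + 1, hp⟩) rfl
    (p := seqMon n b * (X (⟨p, by omega⟩ : Fin n) + X ⟨p + 1, hp⟩)) (by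
      rw [map_mul, rename_seqMon hb, map_add, rename_X, rename_X, Equiv.swap_apply_left,
        Equiv.swap_apply_right, add_comm (X _)])
  have h1 := fun b => seqMon_add_single b (⟨p, by omega⟩ : Fin n)
  have h2 := fun b => seqMon_add_single b (⟨p + 1, hp⟩ : Fin n)
  simp only at h1 h2
  simp only [seqAlt_eq, h1, h2]
  rw [← alternation_C_mul, ← alternation_C_mul, ← alternation_add, ← sub_eq_zero, ← h,
    sub_eq_add_neg, ← neg_one_mul, ← C_1, ← C_neg,
    ← alternation_C_mul, ← alternation_add]
  congr 1
  simp only [C_neg, C_sub, C_1]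
  ring

/-- The symmetric p_2 passes inside the antisymmetrization and multiplies the monomial x^a. -/
theorem psum_two_mul_seqAlt (t : ℝ) (n : ℕ) (a : ℕ → ℕ) :
    psum (Fin n) ℝ 2 * seqAlt t n a =
      ∑ i ∈ range n, seqAlt t n (a + Pi.single i 1 + Pi.single i 1) := by
  refine Eq.trans ?_
    (Fin.sum_univ_eq_sum_range (fun i : ℕ => seqAlt t n (a + Pi.single i 1 + Pi.single i 1)) n)
  simp only [seqAlt_eq, seqMon_add_single]
  unfold alternation
  rw [sum_comm, mul_sum]
  refine sum_congr rfl fun w _ => ?_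
  rw [← mul_sum, ← map_sum, mul_left_comm]
  congr 1
  rw [← psum_isSymmetric (Fin n) ℝ 2 w, ← map_mul]
  congr 1
  rw [psum, sum_mul]
  refine sum_congr rfl fun i _ => ?_
  ring

/-- Moving a unit to the left end of a block of equal exponents. -/
theorem seqAlt_move_block {t : ℝ} {n s : ℕ} {b : ℕ → ℕ} (d : ℕ) (hs : s + d < n)
    (hb : ∀ i, s ≤ i → i ≤ s + d → b i = b s) :
    seqAlt t n (b + Pi.single (s + d) 1) = C (t ^ d) * seqAlt t n (b + Pi.single s 1) := by
  induction d with
  | zero => simp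
  | succ d ih =>
    rw [← add_assoc, seqAlt_move (by omega)
      ((hb _ (by omega) (by omega)).trans (hb _ (by omega) (by omega)).symm),
      ih (by omega) fun i h1 h2 => hb i h1 (by omega), ← mul_assoc, ← C_mul, pow_succ']

theorem seqAlt_pair_block {t : ℝ} {n s : ℕ} {a : ℕ → ℕ} (d : ℕ) (hs : s + d + 1 < n)
    (ha : ∀ i, s ≤ i → i ≤ s + d + 1 → a i = a s) :
    seqAlt t n (a + Pi.single (s + d) 1 + Pi.single (s + d + 1) 1) =
      C (t ^ (2 * d)) * seqAlt t n (a + Pi.single s 1 + Pi.single (s + 1) 1) := by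
  induction d with
  | zero => simp
  | succ d ih =>
    have hs1 : ∀ i j : ℕ, i ≠ j → (Pi.single i 1 : ℕ → ℕ) j = 0 := fun i j h =>
      Pi.single_eq_of_ne h.symm _
    have e0 := ha (s + d) (by omega) (by omega)
    have e1 := ha (s + d + 1) (by omega) (by omega)
    have e2 := ha (s + d + 1 + 1) (by omega) (by omega)
    -- The left unit has to move first: only then are the two exponents under the right unit equal.
    -- Each shift of the pair costs t^2.
    rw [← add_assoc, add_right_comm, seqAlt_move (p := s + d) (by omega), add_right_comm,
      seqAlt_move (p := s + d + 1) (by omega), ih (by omega) fun i h1 h2 => ha i h1 (by omega),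
      ← mul_assoc, ← mul_assoc, ← C_mul, ← C_mul]
    · congr 2; ring
    · simp only [Pi.add_apply]
      rw [hs1 _ _ (by omega), hs1 _ _ (by omega)]
      omega
    · simp only [Pi.add_apply]
      rw [hs1 _ _ (by omega), hs1 _ _ (by omega)]
      omega

theorem seqAlt_two_block {t : ℝ} {n s : ℕ} {a : ℕ → ℕ} (d : ℕ) (hs : s + d + 1 < n)
    (ha : ∀ i, s ≤ i → i ≤ s + d + 1 → a i = a s) :
    seqAlt t n (a + Pi.single (s + d + 1) 1 + Pi.single (s + d + 1) 1) =
      C (t ^ (d + 1)) * seqAlt t n (a + Pi.single s 1 + Pi.single s 1) +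
      C (t ^ d * (t ^ (d + 1) - 1)) * seqAlt t n (a + Pi.single s 1 + Pi.single (s + 1) 1) := by
  induction d with
  | zero =>
    rw [seqAlt_move_two (by omega) (ha _ (by omega) (by omega)).symm]
    simp
  | succ d ih =>
    rw [← add_assoc, seqAlt_move_two (p := s + d + 1) (by omega)
      ((ha _ (by omega) (by omega)).trans (ha _ (by omega) (by omega)).symm),
      ih (by omega) fun i h1 h2 => ha i h1 (by omega)]
    -- Moving the double unit by one place leaves a pair, which this carries to the start of the
    -- block; the pair coefficients combine by t^{d+1}(t^{d+1} - 1) + (t - 1) t^{2(d+1)} =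
    -- t^{d+1}(t^{d+2} - 1).
    have := seqAlt_pair_block (t := t) (d + 1) hs ha
    rw [← add_assoc] at this
    rw [this]
    simp only [map_mul, map_sub, map_pow, map_one]
    ring

/-- The contribution of a block of equal exponents to the product with `p_2`. -/
theorem sum_seqAlt_block {t : ℝ} {n s : ℕ} {a : ℕ → ℕ} (m : ℕ) (hs : s + m ≤ n)
    (ha : ∀ i, s ≤ i → i < s + m → a i = a s) :
    C (1 - t ^ 2) * ∑ i ∈ Ico s (s + m), seqAlt t n (a + Pi.single i 1 + Pi.single i 1) =
      C ((1 + t) * (1 - t ^ m)) * seqAlt t n (a + Pi.single s 1 + Pi.single s 1) -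
      C ((1 - t ^ m) * (1 - t ^ (m - 1))) *
        seqAlt t n (a + Pi.single s 1 + Pi.single (s + 1) 1) := by
  induction m with
  | zero => simp
  | succ m ih =>
    rw [← add_assoc, sum_Ico_succ_top (by omega), mul_add,
      ih (by omega) fun i h1 h2 => ha i h1 (by omega)]
    -- A block with one row has no pair term: there m - 1 = 0, so its coefficient vanishes.
    rcases m with _ | m
    · simp only [map_mul, map_sub, map_add, map_pow, map_one, add_zero, zero_add, pow_zero,
        Nat.sub_self]
      ring
    · have := seqAlt_two_block (t := t) (n := n) (s := s) (a := a) m (by omega) (fun i h1 h2 => ha i h1 (by omega))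
      rw [← add_assoc, this]
      simp only [map_mul, map_sub, map_add, map_pow, map_one, Nat.add_sub_cancel]
      ring

/-! ### Diagrams described by their column lengths -/

theorem lt_colLen_iff {lam : YoungDiagram} {i j : ℕ} : i < lam.colLen j ↔ j < lam.rowLen i := by
  rw [← YoungDiagram.mem_iff_lt_colLen, YoungDiagram.mem_iff_lt_rowLen]

theorem ext_colLen {lam nu : YoungDiagram} (h : ∀ j, lam.colLen j = nu.colLen j) : lam = nu := by
  ext ⟨i, j⟩
  rw [YoungDiagram.mem_cells, YoungDiagram.mem_cells, YoungDiagram.mem_iff_lt_colLen,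
    YoungDiagram.mem_iff_lt_colLen, h]

theorem colLen_rowLen_zero (lam : YoungDiagram) : lam.colLen (lam.rowLen 0) = 0 := by
  by_contra h
  exact lt_irrefl _ (lt_colLen_iff.1 (Nat.pos_of_ne_zero h))

/-- The rows of length c + 1 are those with index in the interval [`mu.colLen (c + 1)`, `mu.colLen
c`). -/
theorem mult_eq (mu : YoungDiagram) (c : ℕ) :
    mult mu (c + 1) = mu.colLen c - mu.colLen (c + 1) := by
  unfold mult YoungDiagram.rowLens
  rw [← Nat.card_Ico, List.count_eq_countP, List.countP_map, List.countP_eq_length_filter,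
    ← List.toFinset_card_of_nodup (List.nodup_range.filter _)]
  congr 1
  ext i
  have h0 := YoungDiagram.colLen_anti mu 0 c (by omega)
  have h1 := lt_colLen_iff (lam := mu) (i := i) (j := c)
  have h2 := lt_colLen_iff (lam := mu) (i := i) (j := c + 1)
  simp only [List.mem_toFinset, List.mem_filter, List.mem_range, Function.comp_apply,
    beq_iff_eq, mem_Ico]
  omega

theorem sum_mult (lam : YoungDiagram) : ∑ i ∈ Icc 1 (lam.rowLen 0), mult lam i = len lam := by
  have h : ∀ r, ∑ i ∈ Icc 1 r, mult lam i + lam.colLen r = lam.colLen 0 := by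
    intro r
    induction r with
    | zero => simp
    | succ r ih =>
      rw [sum_Icc_succ_top (by omega), mult_eq]
      have := YoungDiagram.colLen_anti lam r (r + 1) (by omega)
      omega
  have := h (lam.rowLen 0)
  rw [colLen_rowLen_zero] at this
  exact this

/-- The Young diagram with given column lengths. -/
def ofColLens (f : ℕ → ℕ) (hf : Antitone f) {d : ℕ} (_ : f d = 0) : YoungDiagram where
  cells := (range (f 0) ×ˢ range d).filter fun c => c.1 < f c.2
  isLowerSet := by
    rintro ⟨i, j⟩ ⟨k, l⟩ h hc
    obtain ⟨h1, h2⟩ : k ≤ i ∧ l ≤ j := h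
    simp only [coe_filter, mem_product, mem_range, Set.mem_ofPred_eq] at hc ⊢
    have := hf h2
    omega

theorem colLen_ofColLens (f : ℕ → ℕ) (hf : Antitone f) {d : ℕ} (hd : f d = 0) (j : ℕ) :
    (ofColLens f hf hd).colLen j = f j := by
  refine eq_of_forall_lt_iff fun i => ?_
  rw [← YoungDiagram.mem_iff_lt_colLen, ← YoungDiagram.mem_cells]
  simp only [ofColLens, mem_filter, mem_product, mem_range]
  refine ⟨fun h => h.2, fun h => ⟨⟨h.trans_le (hf (Nat.zero_le j)), ?_⟩, h⟩⟩
  by_contra hj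
  have := hf (not_lt.1 hj)
  omega

/-! ### Adding two boxes -/

theorem succ_mem_skewColumns {mu lam : YoungDiagram} {j : ℕ} :
    j + 1 ∈ skewColumns mu lam ↔ mu.colLen j < lam.colLen j := by
  simp only [skewColumns, mem_image, mem_sdiff, YoungDiagram.mem_cells, Prod.exists,
    YoungDiagram.mem_iff_lt_colLen]
  constructor
  · rintro ⟨i, k, ⟨h1, h2⟩, h3⟩
    obtain rfl : k = j := by omega
    omega
  · intro h
    exact ⟨mu.colLen j, j, ⟨h, lt_irrefl _⟩, rfl⟩

theorem zero_notMem_skewColumns (mu lam : YoungDiagram) : 0 ∉ skewColumns mu lam := by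
  simp [skewColumns]

theorem le_iff_colLen {mu lam : YoungDiagram} : mu ≤ lam ↔ ∀ j, mu.colLen j ≤ lam.colLen j := by
  constructor
  · intro h j
    by_contra hj
    have : (lam.colLen j, j) ∈ mu := YoungDiagram.mem_iff_lt_colLen.2 (not_le.1 hj)
    exact lt_irrefl _ (YoungDiagram.mem_iff_lt_colLen.1 (h this))
  · rintro h ⟨i, j⟩ hc
    have hc : (i, j) ∈ mu := hc
    show (i, j) ∈ lam
    rw [YoungDiagram.mem_iff_lt_colLen] at hc ⊢
    exact hc.trans_le (h j)

/-- Count the new cells column by column; within a column they form an interval. The shift k - 1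
passes from column numbers to cell coordinates. -/
theorem card_eq_add_sum {mu lam : YoungDiagram} (h : mu ≤ lam) :
    lam.card = mu.card +
      ∑ k ∈ skewColumns mu lam, (lam.colLen (k - 1) - mu.colLen (k - 1)) := by
  have h1 : lam.card = mu.card + (lam.cells \ mu.cells).card := by
    rw [add_comm]
    exact (card_sdiff_add_card_eq_card (YoungDiagram.cells_subset_iff.2 h)).symm
  rw [h1, card_eq_sum_card_image (fun c : ℕ × ℕ => c.2 + 1)]
  congr 1
  refine sum_congr rfl fun k hk => ?_
  rw [← Nat.card_Ico, ← card_map (s := Ico _ _)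
    ⟨fun i => (i, k - 1), fun a b hab => (Prod.mk.inj hab).1⟩]
  refine congrArg card ?_
  ext ⟨i, j⟩
  have hk0 : k ≠ 0 := fun h0 => zero_notMem_skewColumns mu lam (h0 ▸ hk)
  simp only [mem_filter, mem_sdiff, YoungDiagram.mem_cells, YoungDiagram.mem_iff_lt_colLen,
    mem_map, mem_Ico]
  constructor
  · rintro ⟨⟨h1, h2⟩, rfl⟩
    exact ⟨i, ⟨not_lt.1 h2, h1⟩, rfl⟩
  · rintro ⟨_, ⟨h1, h2⟩, h3⟩
    obtain ⟨rfl, rfl⟩ := Prod.mk.inj h3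
    exact ⟨⟨h2, not_lt.2 h1⟩, by omega⟩

/-- Column lengths determine a diagram, so this form yields uniqueness of `lam` and reduces the
later facts to arithmetic. -/
theorem addsDominoAt_iff {mu lam : YoungDiagram} {c : ℕ} : AddsDominoAt mu lam (c + 1) ↔
    ∀ j, lam.colLen j = mu.colLen j + if j = c then 2 else 0 := by
  constructor
  · rintro ⟨h1, h2, h3⟩ j
    rw [card_eq_add_sum h1, h3, sum_singleton] at h2
    have h4 := succ_mem_skewColumns (mu := mu) (lam := lam) (j := j)
    have h5 := le_iff_colLen.1 h1 j
    rw [h3, mem_singleton] at h4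
    split_ifs with h
    · subst h
      simp only [Nat.add_sub_cancel] at h2
      omega
    · omega
  · intro h
    have h1 : mu ≤ lam := le_iff_colLen.2 fun j => by rw [h]; omega
    have h3 : skewColumns mu lam = {c + 1} := by
      ext k
      rcases k with _ | k
      · simp [zero_notMem_skewColumns]
      · rw [succ_mem_skewColumns, h, mem_singleton]
        split_ifs <;> omega
    refine ⟨h1, ?_, h3⟩
    rw [card_eq_add_sum h1, h3, sum_singleton, h]
    simp

theorem addsPairAt_iff {mu lam : YoungDiagram} {c : ℕ} : AddsPairAt mu lam (c + 1) ↔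
    ∀ j, lam.colLen j = mu.colLen j + if j = c ∨ j = c + 1 then 1 else 0 := by
  constructor
  · rintro ⟨h1, h2, h3⟩ j
    rw [card_eq_add_sum h1, h3, sum_pair (by omega)] at h2
    have h4 := succ_mem_skewColumns (mu := mu) (lam := lam) (j := j)
    have h5 := succ_mem_skewColumns (mu := mu) (lam := lam) (j := c)
    have h6 := succ_mem_skewColumns (mu := mu) (lam := lam) (j := c + 1)
    have h7 := le_iff_colLen.1 h1 j
    rw [h3] at h4 h5 h6
    simp only [mem_insert, mem_singleton, true_or, or_true, true_iff] at h4 h5 h6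
    simp only [Nat.add_sub_cancel] at h2
    split_ifs with h
    · rcases h with rfl | rfl <;> omega
    · omega
  · intro h
    have h1 : mu ≤ lam := le_iff_colLen.2 fun j => by rw [h]; omega
    have h3 : skewColumns mu lam = {c + 1, c + 1 + 1} := by
      ext k
      rcases k with _ | k
      · simp [zero_notMem_skewColumns]
      · rw [succ_mem_skewColumns, h, mem_insert, mem_singleton]
        split_ifs <;> omega
    refine ⟨h1, ?_, h3⟩
    rw [card_eq_add_sum h1, h3, sum_pair (by omega), h, h]
    simp

theorem AddsDominoAt.pos {mu lam : YoungDiagram} {k : ℕ} (h : AddsDominoAt mu lam k) : 0 < k := by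
  refine Nat.pos_of_ne_zero fun h0 => zero_notMem_skewColumns mu lam ?_
  rw [h.2.2, h0]; simp

theorem AddsPairAt.pos {mu lam : YoungDiagram} {k : ℕ} (h : AddsPairAt mu lam k) : 0 < k := by
  refine Nat.pos_of_ne_zero fun h0 => zero_notMem_skewColumns mu lam ?_
  rw [h.2.2, h0]; simp

/-- The column to the left does not grow, and must still be at least as long as the column that
gains two boxes. -/
theorem AddsDominoAt.two_le_mult {mu lam : YoungDiagram} {c : ℕ}
    (h : AddsDominoAt mu lam (c + 2)) : 2 ≤ mult mu (c + 1) := by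
  rw [mult_eq]
  have h1 := addsDominoAt_iff.1 h c
  have h2 := addsDominoAt_iff.1 h (c + 1)
  have h3 := YoungDiagram.colLen_anti lam c (c + 1) (by omega)
  rw [if_neg (by omega)] at h1
  rw [if_pos rfl] at h2
  omega

theorem AddsPairAt.one_le_mult {mu lam : YoungDiagram} {c : ℕ}
    (h : AddsPairAt mu lam (c + 2)) : 1 ≤ mult mu (c + 1) := by
  rw [mult_eq]
  have h1 := addsPairAt_iff.1 h c
  have h2 := addsPairAt_iff.1 h (c + 1)
  have h3 := YoungDiagram.colLen_anti lam c (c + 1) (by omega)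
  rw [if_neg (by omega)] at h1
  rw [if_pos (by omega)] at h2
  omega

/-- The new column lengths can fail to decrease only at the column on the left; for c = 0 there is
none. -/
theorem exists_addsDominoAt {mu : YoungDiagram} {c : ℕ} (hc : c = 0 ∨ 2 ≤ mult mu c) :
    ∃ lam, AddsDominoAt mu lam (c + 1) := by
  have hf : Antitone fun j => mu.colLen j + if j = c then 2 else 0 := by
    refine antitone_nat_of_succ_le fun j => ?_
    have h := YoungDiagram.colLen_anti mu j (j + 1) (by omega)
    split_ifs with h1 h2 h2
    · omega
    · subst h1
      rw [mult_eq] at hc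
      omega
    · omega
    · omega
  refine ⟨ofColLens _ hf (d := mu.rowLen 0 + c + 1) ?_, addsDominoAt_iff.2
    (colLen_ofColLens _ _ _)⟩
  have := YoungDiagram.colLen_anti mu (mu.rowLen 0) (mu.rowLen 0 + c + 1) (by omega)
  rw [colLen_rowLen_zero] at this
  rw [if_neg (by omega)]
  omega

theorem exists_addsPairAt {mu : YoungDiagram} {c : ℕ} (hc : c = 0 ∨ 1 ≤ mult mu c) :
    ∃ lam, AddsPairAt mu lam (c + 1) := by
  have hf : Antitone fun j => mu.colLen j + if j = c ∨ j = c + 1 then 1 else 0 := by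
    refine antitone_nat_of_succ_le fun j => ?_
    have h := YoungDiagram.colLen_anti mu j (j + 1) (by omega)
    split_ifs with h1 h2 h2
    · omega
    · obtain rfl : j + 1 = c := by omega
      rw [mult_eq] at hc
      omega
    · omega
    · omega
  refine ⟨ofColLens _ hf (d := mu.rowLen 0 + c + 2) ?_, addsPairAt_iff.2
    (colLen_ofColLens _ _ _)⟩
  have := YoungDiagram.colLen_anti mu (mu.rowLen 0) (mu.rowLen 0 + c + 2) (by omega)
  rw [colLen_rowLen_zero] at this
  rw [if_neg (by omega)]
  omega

theorem AddsDominoAt.unique {mu lam nu : YoungDiagram} {k : ℕ} (h : AddsDominoAt mu lam k)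
    (h' : AddsDominoAt mu nu k) : lam = nu := by
  obtain ⟨c, rfl⟩ := Nat.exists_eq_add_of_lt h.pos
  rw [zero_add] at h h'
  refine ext_colLen fun j => ?_
  rw [addsDominoAt_iff.1 h, addsDominoAt_iff.1 h']

theorem AddsPairAt.unique {mu lam nu : YoungDiagram} {k : ℕ} (h : AddsPairAt mu lam k)
    (h' : AddsPairAt mu nu k) : lam = nu := by
  obtain ⟨c, rfl⟩ := Nat.exists_eq_add_of_lt h.pos
  rw [zero_add] at h h'
  refine ext_colLen fun j => ?_
  rw [addsPairAt_iff.1 h, addsPairAt_iff.1 h']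

theorem AddsDominoAt.column_unique {mu lam : YoungDiagram} {k l : ℕ} (h : AddsDominoAt mu lam k)
    (h' : AddsDominoAt mu lam l) : k = l :=
  singleton_injective (h.2.2.symm.trans h'.2.2)

theorem AddsPairAt.column_unique {mu lam : YoungDiagram} {k l : ℕ} (h : AddsPairAt mu lam k)
    (h' : AddsPairAt mu lam l) : k = l := by
  have e := h.2.2.symm.trans h'.2.2
  have h1 : k ∈ ({l, l + 1} : Finset ℕ) := e ▸ mem_insert_self _ _
  have h2 : l ∈ ({k, k + 1} : Finset ℕ) := e ▸ mem_insert_self _ _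
  simp only [mem_insert, mem_singleton] at h1 h2
  omega

theorem AddsDominoAt.not_addsPairAt {mu lam : YoungDiagram} {k l : ℕ}
    (h : AddsDominoAt mu lam k) : ¬ AddsPairAt mu lam l := by
  intro h'
  have e := congrArg card (h.2.2.symm.trans h'.2.2)
  rw [card_singleton, card_pair (by omega)] at e
  omega

/-- This bound ensures that the finite sum defining `xiCoeff` reaches every possible domino. -/
theorem AddsDominoAt.le_rowLen {mu lam : YoungDiagram} {k : ℕ} (h : AddsDominoAt mu lam k) :
    k ≤ mu.rowLen 0 + 1 := by
  rcases k with _ | _ | c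
  · omega
  · omega
  · have h1 := h.two_le_mult
    rw [mult_eq] at h1
    have := lt_colLen_iff.1 (show 0 < mu.colLen c by omega)
    omega

theorem AddsPairAt.le_rowLen {mu lam : YoungDiagram} {k : ℕ} (h : AddsPairAt mu lam k) :
    k ≤ mu.rowLen 0 + 1 := by
  rcases k with _ | _ | c
  · omega
  · omega
  · have h1 := h.one_le_mult
    rw [mult_eq] at h1
    have := lt_colLen_iff.1 (show 0 < mu.colLen c by omega)
    omega

theorem AddsDominoAt.rowLen_eq {mu lam : YoungDiagram} {c : ℕ} (h : AddsDominoAt mu lam (c + 1)) :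
    lam.rowLen = mu.rowLen + Pi.single (mu.colLen c) 1 + Pi.single (mu.colLen c + 1) 1 := by
  funext i
  refine eq_of_forall_lt_iff fun j => ?_
  rw [← lt_colLen_iff, addsDominoAt_iff.1 h]
  simp only [Pi.add_apply, Pi.single_apply]
  have h1 := lt_colLen_iff (lam := mu) (i := i) (j := j)
  have h2 := lt_colLen_iff (lam := mu) (i := i) (j := c)
  rcases c with _ | c
  · split_ifs <;> grind
  · have h3 := lt_colLen_iff (lam := mu) (i := i) (j := c)
    have h4 := h.two_le_mult
    rw [mult_eq] at h4
    split_ifs <;> grind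

/-- Each box goes to the foot of its column. When the two columns of `mu` are equally long, the
boxes share a row and both unit vectors sit at the same index. -/
theorem AddsPairAt.rowLen_eq {mu lam : YoungDiagram} {c : ℕ} (h : AddsPairAt mu lam (c + 1)) :
    lam.rowLen = mu.rowLen + Pi.single (mu.colLen c) 1 + Pi.single (mu.colLen (c + 1)) 1 := by
  funext i
  refine eq_of_forall_lt_iff fun j => ?_
  rw [← lt_colLen_iff, addsPairAt_iff.1 h]
  simp only [Pi.add_apply, Pi.single_apply]
  have h1 := lt_colLen_iff (lam := mu) (i := i) (j := j)
  have h2 := lt_colLen_iff (lam := mu) (i := i) (j := c)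
  have h2' := lt_colLen_iff (lam := mu) (i := i) (j := c + 1)
  have h5 := YoungDiagram.colLen_anti mu c (c + 1) (by omega)
  rcases c with _ | c
  · split_ifs <;> grind
  · have h3 := lt_colLen_iff (lam := mu) (i := i) (j := c)
    have h4 := h.one_le_mult
    rw [mult_eq] at h4
    split_ifs <;> grind

/-! ### The statistic n(λ) and the normalizing constants -/

theorem nStat_eq {lam : YoungDiagram} {n : ℕ} (hn : len lam ≤ n) :
    nStat lam = ∑ i ∈ range n, i * lam.rowLen i := by
  refine sum_subset (range_mono hn) fun i _ hi => ?_
  rw [len_le_iff.1 (not_lt.1 fun h => hi (mem_range.2 h)), mul_zero]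

theorem nStat_add_single {mu lam : YoungDiagram} {p q : ℕ}
    (h : lam.rowLen = mu.rowLen + Pi.single p 1 + Pi.single q 1) :
    nStat lam = nStat mu + p + q := by
  have e : ∀ r n : ℕ, r < n → ∑ i ∈ range n, i * (Pi.single r 1 : ℕ → ℕ) i = r := by
    intro r n hr
    rw [sum_eq_single r]
    · simp
    · intro b _ hb
      rw [Pi.single_eq_of_ne hb, mul_zero]
    · intro h
      exact absurd (mem_range.2 hr) h
  rw [nStat_eq (lam := lam) (n := len lam + len mu + p + q + 1) (by omega),
    nStat_eq (lam := mu) (n := len lam + len mu + p + q + 1) (by omega), h]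
  simp only [Pi.add_apply, mul_add, sum_add_distrib]
  rw [e _ _ (by omega), e _ _ (by omega)]

/-- Each factor 1 - t^j of b is 1 - t times a factor of v, and there are ∑ m_i = ℓ of them. -/
theorem bPart_mul_vNum {t : ℝ} (ht : t ∈ Set.Ioo (-1 : ℝ) 1) (n : ℕ) (lam : YoungDiagram) :
    bPart t lam * vNum t (n - len lam) = (1 - t) ^ len lam * vPart t n lam := by
  have h1 : 1 - t ≠ 0 := by simpa using one_sub_pow_ne ht le_rfl
  have h : bPart t lam = (1 - t) ^ len lam *
      ∏ i ∈ Icc 1 (lam.rowLen 0), vNum t (mult lam i) := by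
    rw [← sum_mult, ← prod_pow_eq_pow_sum, ← prod_mul_distrib]
    refine prod_congr rfl fun i _ => ?_
    rw [vNum, prod_div_distrib, prod_const, Nat.card_Icc, Nat.add_sub_cancel]
    field_simp
  rw [h, vPart]
  ring

theorem vNum_add_one (t : ℝ) (m : ℕ) :
    vNum t (m + 1) = vNum t m * ((1 - t ^ (m + 1)) / (1 - t)) := by
  rw [vNum, prod_Icc_succ_top (by omega), vNum]

theorem vdm_mul_polyP (t : ℝ) {n : ℕ} {lam : YoungDiagram} (hn : len lam ≤ n) :
    vdm n * polyP t lam n = C (vPart t n lam)⁻¹ * seqAlt t n lam.rowLen := by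
  rw [polyP, if_neg (by omega), vdm_mul_choose]
  rfl

/-! ### Linear independence -/

/-- The diagram with the first column removed. -/
def removeColumn (lam : YoungDiagram) : YoungDiagram :=
  ofColLens (fun j => lam.colLen (j + 1))
    (fun _ _ h => YoungDiagram.colLen_anti lam _ _ (Nat.succ_le_succ h))
    (d := lam.rowLen 0) (Nat.eq_zero_of_le_zero
      ((YoungDiagram.colLen_anti lam _ _ (Nat.le_succ _)).trans_eq (colLen_rowLen_zero lam)))

theorem colLen_removeColumn (lam : YoungDiagram) (j : ℕ) :
    (removeColumn lam).colLen j = lam.colLen (j + 1) := colLen_ofColLens _ _ _ _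

theorem rowLen_removeColumn (lam : YoungDiagram) (i : ℕ) :
    (removeColumn lam).rowLen i = lam.rowLen i - 1 := by
  refine eq_of_forall_lt_iff fun j => ?_
  rw [← lt_colLen_iff, colLen_removeColumn, lt_colLen_iff]
  omega

theorem len_removeColumn_le (lam : YoungDiagram) : len (removeColumn lam) ≤ len lam :=
  (colLen_removeColumn lam 0).trans_le (YoungDiagram.colLen_anti lam _ _ (Nat.zero_le _))

theorem seqAlt_succ (t : ℝ) (n : ℕ) {a b : ℕ → ℕ} (h : ∀ i < n, a i = b i + 1) :
    seqAlt t n a = (∏ i, X i) * seqAlt t n b := by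
  unfold seqAlt altSum
  rw [mul_sum]
  refine sum_congr rfl fun w _ => ?_
  have e : ∏ i : Fin n, (X (w i) : MvPolynomial (Fin n) ℝ) ^ a i =
      (∏ i, X i) * ∏ i : Fin n, X (w i) ^ b i := by
    rw [← Equiv.prod_comp w (fun i => (X i : MvPolynomial (Fin n) ℝ)), ← prod_mul_distrib]
    refine prod_congr rfl fun i _ => ?_
    rw [h i i.2, pow_succ']
  rw [e]
  ring

/-- In exactly ℓ(λ) variables every exponent is positive, so x_1 ⋯ x_ℓ comes out of the
antisymmetrization. The scalar is the ratio of the two normalizations. -/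
theorem polyP_eq_prod_mul {t : ℝ} (ht : t ∈ Set.Ioo (-1 : ℝ) 1) (lam : YoungDiagram) :
    ∃ r : ℝ, r ≠ 0 ∧ polyP t lam (len lam) =
      (∏ i, X i) * (C r * polyP t (removeColumn lam) (len lam)) := by
  have h1 := vPart_ne_zero ht (len lam) lam
  have h2 := vPart_ne_zero ht (len lam) (removeColumn lam)
  refine ⟨(vPart t (len lam) lam)⁻¹ * vPart t (len lam) (removeColumn lam),
    mul_ne_zero (inv_ne_zero h1) h2, mul_left_cancel₀ (vdm_ne_zero (len lam)) ?_⟩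
  have e : ∀ x y : ℝ, ∀ v p q : MvPolynomial (Fin (len lam)) ℝ,
      v * (q * (C (x * y) * p)) = C x * (q * (C y * (v * p))) := by
    intro x y v p q
    rw [C_mul]; ring
  rw [vdm_mul_polyP t le_rfl, e, vdm_mul_polyP t (len_removeColumn_le lam),
    ← mul_assoc (C (vPart t (len lam) (removeColumn lam))), ← C_mul, mul_inv_cancel₀ h2, C_1,
    one_mul, seqAlt_succ t (len lam) (b := (removeColumn lam).rowLen)]
  intro i hi
  have := lt_colLen_iff.1 (show i < lam.colLen 0 from hi)
  rw [rowLen_removeColumn]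
  omega

theorem len_bot_iff {lam : YoungDiagram} : len lam = 0 ↔ lam = ⊥ := by
  constructor
  · intro h
    refine ext_colLen fun j => ?_
    have h1 := YoungDiagram.colLen_anti lam 0 j (Nat.zero_le j)
    have h2 : (⊥ : YoungDiagram).colLen j = 0 := by
      by_contra h3
      exact YoungDiagram.notMem_bot _
        (YoungDiagram.mem_iff_lt_colLen.2 (Nat.pos_of_ne_zero h3))
    have h : lam.colLen 0 = 0 := h
    omega
  · rintro rfl
    by_contra h3
    exact YoungDiagram.notMem_bot _
      (YoungDiagram.mem_iff_lt_colLen.2 (Nat.pos_of_ne_zero h3))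

/-- Double induction, on the number of variables and on a bound d for the first row; removing a
column lowers d. -/
theorem polyP_independent {t : ℝ} (ht : t ∈ Set.Ioo (-1 : ℝ) 1) (n d : ℕ)
    (S : Finset YoungDiagram) (c : YoungDiagram → ℝ)
    (hS : ∀ lam ∈ S, len lam ≤ n ∧ lam.rowLen 0 ≤ d)
    (h0 : ∑ lam ∈ S, C (c lam) * polyP t lam n = 0) : ∀ lam ∈ S, c lam = 0 := by
  classical
  induction n generalizing d S c with
  | zero =>
    intro lam hl
    have hb : ∀ nu ∈ S, nu = lam := fun nu hn => by
      rw [len_bot_iff.1 (Nat.le_zero.1 (hS nu hn).1), len_bot_iff.1 (Nat.le_zero.1 (hS lam hl).1)]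
    rw [sum_eq_single lam (fun b hb' hne => absurd (hb b hb') hne) (fun h => absurd hl h)] at h0
    have h1 := vdm_mul_polyP t (hS lam hl).1
    have h2 : seqAlt t 0 lam.rowLen = 1 := by simp [seqAlt, altSum]
    rw [h2, mul_one] at h1
    have h3 : vdm 0 * (C (c lam) * polyP t lam 0) = C (c lam * (vPart t 0 lam)⁻¹) := by
      rw [mul_left_comm, h1, C_mul]
    rw [h0, mul_zero, eq_comm, C_eq_zero] at h3
    exact (mul_eq_zero.1 h3).resolve_right (inv_ne_zero (vPart_ne_zero ht 0 lam))
  | succ n ihn =>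
    -- Setting the last variable to 0 kills the diagrams with n + 1 rows, so the shorter ones fall
    -- under the induction on n.
    have small : ∀ (d : ℕ) (S : Finset YoungDiagram) (c : YoungDiagram → ℝ),
        (∀ lam ∈ S, len lam ≤ n + 1 ∧ lam.rowLen 0 ≤ d) →
        ∑ lam ∈ S, C (c lam) * polyP t lam (n + 1) = 0 → ∀ lam ∈ S, len lam ≤ n → c lam = 0 := by
      intro d S c hS h0 lam hl hln
      refine ihn d (S.filter fun nu => len nu ≤ n) c ?_ ?_ lam (mem_filter.2 ⟨hl, hln⟩)
      · intro nu hn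
        rw [mem_filter] at hn
        exact ⟨hn.2, (hS nu hn.1).2⟩
      · have := congrArg (setLastZero n) h0
        rw [map_sum, map_zero] at this
        rw [← this, sum_filter]
        refine sum_congr rfl fun nu _ => ?_
        rw [map_mul, setLastZero_polyP ht]
        split_ifs with h
        · congr 1
          exact ((setLastZero n).commutes (c nu)).symm
        · rw [polyP, if_pos (not_le.1 h), mul_zero]
    induction d generalizing S c with
    | zero =>
      intro lam hl
      refine small 0 S c hS h0 lam hl ?_
      exact (len_le_iff.2 (Nat.le_zero.1 (hS lam hl).2)).trans (Nat.zero_le n)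
    | succ d ihd =>
      intro lam hl
      by_cases hln : len lam ≤ n
      · exact small _ S c hS h0 lam hl hln
      choose r hr0 hr using polyP_eq_prod_mul ht
      set T := S.filter fun nu => len nu = n + 1 with hT
      have hlT : lam ∈ T := mem_filter.2 ⟨hl, by have := (hS lam hl).1; omega⟩
      -- In T the first column always has length n + 1, so its removal loses no information.
      have hinj : Set.InjOn removeColumn (T : Set YoungDiagram) := by
        intro x hx y hy hxy
        have hx := (mem_filter.1 (mem_coe.1 hx)).2
        have hy := (mem_filter.1 (mem_coe.1 hy)).2
        refine ext_colLen fun j => ?_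
        rcases j with _ | j
        · exact hx.trans hy.symm
        · rw [← colLen_removeColumn, hxy, colLen_removeColumn]
      have h1 : ∑ nu ∈ T, C (c nu * r nu) * polyP t (removeColumn nu) (n + 1) = 0 := by
        have hX : (∏ i : Fin (n + 1), X i : MvPolynomial (Fin (n + 1)) ℝ) ≠ 0 :=
          prod_ne_zero_iff.2 fun i _ => X_ne_zero i
        refine (mul_eq_zero.1 ?_).resolve_left hX
        rw [← h0, hT, sum_filter, mul_sum]
        refine sum_congr rfl fun nu hn => ?_
        split_ifs with h
        · have := hr nu
          rw [h] at this
          rw [this, C_mul]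
          ring
        · rw [small _ S c hS h0 nu hn (by have := (hS nu hn).1; omega)]
          simp
      -- The coefficients are carried along the inverse of column removal on T.
      have h2 := ihd (T.image removeColumn)
        (fun nu => c (Function.invFunOn removeColumn T nu) *
          r (Function.invFunOn removeColumn T nu)) ?_ ?_ (removeColumn lam)
          (mem_image_of_mem _ hlT)
      · rw [hinj.leftInvOn_invFunOn hlT] at h2
        exact (mul_eq_zero.1 h2).resolve_right (hr0 lam)
      · intro nu hn
        obtain ⟨x, hx, rfl⟩ := mem_image.1 hn
        have hx' := (mem_filter.1 hx).1
        refine ⟨(len_removeColumn_le x).trans (hS x hx').1, ?_⟩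
        rw [rowLen_removeColumn]
        have := (hS x hx').2
        omega
      · rw [sum_image hinj, ← h1]
        refine sum_congr rfl fun x hx => ?_
        rw [hinj.leftInvOn_invFunOn hx]

/-! ### From finitely many variables to symmetric functions -/

theorem bPart_ne_zero {t : ℝ} (ht : t ∈ Set.Ioo (-1 : ℝ) 1) (lam : YoungDiagram) :
    bPart t lam ≠ 0 :=
  prod_ne_zero_iff.2 fun _ _ => prod_ne_zero_iff.2 fun _ hj =>
    one_sub_pow_ne ht (mem_Icc.1 hj).1

/-- The restriction of symmetric functions to `n` variables. -/
noncomputable def restrict (n : ℕ) : Sym →ₐ[ℝ] MvPolynomial (Fin n) ℝ :=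
  (Pi.evalAlgHom ℝ _ n).comp Sym.val

theorem restrict_hlQtilde {t : ℝ} (ht : t ∈ Set.Ioo (-1 : ℝ) 1) (lam : YoungDiagram) (n : ℕ) :
    restrict n (hlQtilde ht lam) = C ((-1) ^ nStat lam * bPart t lam) * polyP t lam n := by
  rw [hlQtilde, hlQ, smul_smul, map_smul, smul_eq_C_mul]
  rfl

theorem hlQtilde_linearIndependent {t : ℝ} (ht : t ∈ Set.Ioo (-1 : ℝ) 1) :
    LinearIndependent ℝ (hlQtilde ht) := by
  rw [linearIndependent_iff]
  intro c hc
  ext lam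
  by_contra hl
  have h := congrArg (restrict (c.support.sup len)) hc
  rw [map_zero, Finsupp.linearCombination_apply, Finsupp.sum, map_sum] at h
  have := polyP_independent ht (c.support.sup len) (c.support.sup fun nu => nu.rowLen 0) c.support
    (fun nu => c nu * ((-1) ^ nStat nu * bPart t nu))
    (fun nu hn => ⟨le_sup (f := len) hn, le_sup (f := fun nu => nu.rowLen 0) hn⟩) ?_ lam
    (Finsupp.mem_support_iff.2 hl)
  · rcases mul_eq_zero.1 this with h | h
    · exact hl h
    · exact mul_ne_zero (pow_ne_zero _ (by norm_num)) (bPart_ne_zero ht lam) h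
  · rw [← h]
    refine sum_congr rfl fun nu _ => ?_
    rw [map_smul, restrict_hlQtilde, smul_eq_C_mul, C_mul, mul_assoc]

/-- The component in n variables is the one in n + 1 variables with the last variable set to 0, so
equality descends from large n. -/
theorem eq_of_restrict_eq {f g : Sym} {m : ℕ} (h : ∀ n, m ≤ n → restrict n f = restrict n g) :
    f = g := by
  apply Subtype.ext
  funext n
  have key : ∀ d n, m ≤ n + d → f.1 n = g.1 n := by
    intro d
    induction d with
    | zero => exact fun n hn => h n hn
    | succ d ih =>
      intro n hn
      rw [← f.2.2.1 n, ← g.2.2.1 n, ih (n + 1) (by omega)]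
  exact key m n (by omega)

/-- The factor relating `Q̃_lam` in `n` variables to the symmetrization of `x ^ lam`. -/
noncomputable def qFactor (t : ℝ) (n : ℕ) (lam : YoungDiagram) : ℝ :=
  (-1) ^ nStat lam * ((1 - t) ^ len lam / vNum t (n - len lam))

/-- In b_λ / v_λ the multiplicities of positive parts cancel, so apart from the sign the factor
depends on λ through ℓ(λ) alone. -/
theorem vdm_mul_hlQtilde {t : ℝ} (ht : t ∈ Set.Ioo (-1 : ℝ) 1) {lam : YoungDiagram} {n : ℕ}
    (hn : len lam ≤ n) : vdm n * restrict n (hlQtilde ht lam) =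
      C (qFactor t n lam) * seqAlt t n lam.rowLen := by
  rw [restrict_hlQtilde, mul_left_comm, vdm_mul_polyP t hn, ← mul_assoc, ← C_mul, qFactor]
  congr 2
  rw [mul_assoc]
  congr 1
  rw [← div_eq_mul_inv, div_eq_div_iff (vPart_ne_zero ht n lam) (vNum_ne_zero ht _),
    bPart_mul_vNum ht]

/-! ### Multiplication by `p_2` -/

/-- The coefficient of the diagram with two more boxes in the column `k`. -/
noncomputable def dominoCoeff (t : ℝ) (mu : YoungDiagram) (k : ℕ) : ℝ :=
  if k = 1 then 1 else (1 - t ^ mult mu (k - 1)) * (1 - t ^ (mult mu (k - 1) - 1))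

/-- The coefficient of the diagram with one more box in each of the columns `k` and `k + 1`. -/
noncomputable def pairCoeff (t : ℝ) (mu : YoungDiagram) (k : ℕ) : ℝ :=
  (-t) ^ mult mu k * (1 + t) * (if k = 1 then 1 else 1 - t ^ mult mu (k - 1))

open Classical in
/-- The term `dominoCoeff t mu k • lam` with `AddsDominoAt mu lam k`, or `0`. -/
noncomputable def dominoTerm (t : ℝ) (mu : YoungDiagram) (k : ℕ) : YoungDiagram →₀ ℝ :=
  if h : ∃ lam, AddsDominoAt mu lam k then Finsupp.single h.choose (dominoCoeff t mu k) else 0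

open Classical in
/-- The term `pairCoeff t mu k • lam` with `AddsPairAt mu lam k`, or `0`. -/
noncomputable def pairTerm (t : ℝ) (mu : YoungDiagram) (k : ℕ) : YoungDiagram →₀ ℝ :=
  if h : ∃ lam, AddsPairAt mu lam k then Finsupp.single h.choose (pairCoeff t mu k) else 0

theorem dominoTerm_eq_single {t : ℝ} {mu lam : YoungDiagram} {k : ℕ}
    (h : AddsDominoAt mu lam k) : dominoTerm t mu k = Finsupp.single lam (dominoCoeff t mu k) := by
  have h' : ∃ lam, AddsDominoAt mu lam k := ⟨lam, h⟩
  rw [dominoTerm, dif_pos h', h'.choose_spec.unique h]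

theorem pairTerm_eq_single {t : ℝ} {mu lam : YoungDiagram} {k : ℕ}
    (h : AddsPairAt mu lam k) : pairTerm t mu k = Finsupp.single lam (pairCoeff t mu k) := by
  have h' : ∃ lam, AddsPairAt mu lam k := ⟨lam, h⟩
  rw [pairTerm, dif_pos h', h'.choose_spec.unique h]

theorem dominoTerm_apply_of_not {t : ℝ} {mu lam : YoungDiagram} {k : ℕ}
    (h : ¬ AddsDominoAt mu lam k) : dominoTerm t mu k lam = 0 := by
  unfold dominoTerm
  split_ifs with h'
  · exact Finsupp.single_eq_of_ne fun e => h (e ▸ h'.choose_spec)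
  · rfl

theorem pairTerm_apply_of_not {t : ℝ} {mu lam : YoungDiagram} {k : ℕ}
    (h : ¬ AddsPairAt mu lam k) : pairTerm t mu k lam = 0 := by
  unfold pairTerm
  split_ifs with h'
  · exact Finsupp.single_eq_of_ne fun e => h (e ▸ h'.choose_spec)
  · rfl

/-- The coefficients of the product of `(1 - t ^ 2) p_2` with `Q̃_mu`. -/
noncomputable def xiCoeff (t : ℝ) (mu : YoungDiagram) : YoungDiagram →₀ ℝ :=
  ∑ c ∈ range (mu.rowLen 0 + 1), (dominoTerm t mu (c + 1) + pairTerm t mu (c + 1))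

theorem xiCoeff_apply (t : ℝ) (mu lam : YoungDiagram) : xiCoeff t mu lam =
    ∑ c ∈ range (mu.rowLen 0 + 1),
      (dominoTerm t mu (c + 1) lam + pairTerm t mu (c + 1) lam) := by
  simp [xiCoeff, Finsupp.finsetSum_apply]

theorem xiCoeff_of_not_upUp {t : ℝ} {mu lam : YoungDiagram} (h : ¬ UpUp mu lam) :
    xiCoeff t mu lam = 0 := by
  rw [xiCoeff_apply]
  refine sum_eq_zero fun c _ => ?_
  rw [dominoTerm_apply_of_not fun h' => h ⟨_, Or.inl h'⟩,
    pairTerm_apply_of_not fun h' => h ⟨_, Or.inr h'⟩, add_zero]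

theorem xiCoeff_of_addsDominoAt {t : ℝ} {mu lam : YoungDiagram} {k : ℕ}
    (h : AddsDominoAt mu lam k) : xiCoeff t mu lam = dominoCoeff t mu k := by
  obtain ⟨c, rfl⟩ := Nat.exists_eq_add_of_lt h.pos
  rw [zero_add] at h ⊢
  have hk := h.le_rowLen
  rw [xiCoeff_apply, sum_eq_single c]
  · rw [pairTerm_apply_of_not h.not_addsPairAt, dominoTerm_eq_single h, Finsupp.single_eq_same,
      add_zero]
  · intro b _ hb
    rw [dominoTerm_apply_of_not fun h' => hb (Nat.succ_injective (h'.column_unique h)),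
      pairTerm_apply_of_not h.not_addsPairAt, add_zero]
  · intro hc
    exact absurd (mem_range.2 (by omega)) hc

theorem xiCoeff_of_addsPairAt {t : ℝ} {mu lam : YoungDiagram} {k : ℕ}
    (h : AddsPairAt mu lam k) : xiCoeff t mu lam = pairCoeff t mu k := by
  obtain ⟨c, rfl⟩ := Nat.exists_eq_add_of_lt h.pos
  rw [zero_add] at h ⊢
  have hk := h.le_rowLen
  have hd : ∀ l, ¬ AddsDominoAt mu lam l := fun l h' => h'.not_addsPairAt h
  rw [xiCoeff_apply, sum_eq_single c]
  · rw [dominoTerm_apply_of_not (hd _), pairTerm_eq_single h, Finsupp.single_eq_same,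
      zero_add]
  · intro b _ hb
    rw [pairTerm_apply_of_not fun h' => hb (Nat.succ_injective (h'.column_unique h)),
      dominoTerm_apply_of_not (hd _), add_zero]
  · intro hc
    exact absurd (mem_range.2 (by omega)) hc

theorem one_sub_pow_pos {t : ℝ} (ht : t ∈ Set.Ioo (-1 : ℝ) 1) {i : ℕ} (hi : 1 ≤ i) :
    0 < 1 - t ^ i := by
  have : |t ^ i| < 1 := by
    rw [abs_pow]
    exact pow_lt_one₀ (abs_nonneg t) (abs_lt.2 ht) (by omega)
  have := (abs_lt.1 this).2
  linarith

/-- Here -t and 1 + t are positive, and the existence of `lam` forces multiplicities that make every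
exponent in a factor 1 - t^i at least 1. -/
theorem xiCoeff_pos {t : ℝ} (ht : t ∈ Set.Ioo (-1 : ℝ) 1) (ht0 : t < 0) {mu lam : YoungDiagram}
    (h : UpUp mu lam) : 0 < xiCoeff t mu lam := by
  obtain ⟨k, h | h⟩ := h
  · rw [xiCoeff_of_addsDominoAt h, dominoCoeff]
    split_ifs with hk
    · exact one_pos
    · obtain ⟨c, rfl⟩ : ∃ c, k = c + 2 := ⟨k - 2, by have := h.pos; omega⟩
      have := h.two_le_mult
      exact mul_pos (one_sub_pow_pos ht (show 1 ≤ mult mu (c + 1) by omega))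
        (one_sub_pow_pos ht (show 1 ≤ mult mu (c + 1) - 1 by omega))
  · rw [xiCoeff_of_addsPairAt h, pairCoeff]
    refine mul_pos (mul_pos (pow_pos (by linarith) _) (by linarith [ht.1])) ?_
    split_ifs with hk
    · exact one_pos
    · obtain ⟨c, rfl⟩ : ∃ c, k = c + 2 := ⟨k - 2, by have := h.pos; omega⟩
      exact one_sub_pow_pos ht h.one_le_mult

/-! ### Blocks of equal rows and comparison of coefficients -/

/-- The number of parts equal to `c`, when `mu` is viewed as a sequence of `n` parts. -/
def blockLen (n : ℕ) (mu : YoungDiagram) (c : ℕ) : ℕ := if c = 0 then n - len mu else mult mu c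

theorem mem_block_iff {n : ℕ} {mu : YoungDiagram} (hn : len mu ≤ n) {c i : ℕ} :
    i ∈ Ico (mu.colLen c) (mu.colLen c + blockLen n mu c) ↔ i < n ∧ mu.rowLen i = c := by
  rw [mem_Ico]
  have h1 := lt_colLen_iff (lam := mu) (i := i) (j := c)
  have hn : mu.colLen 0 ≤ n := hn
  rcases c with _ | c
  · have h2 : len mu = mu.colLen 0 := rfl
    rw [blockLen, if_pos rfl, h2]
    omega
  · have h2 := lt_colLen_iff (lam := mu) (i := i) (j := c)
    have h3 := YoungDiagram.colLen_anti mu c (c + 1) (by omega)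
    have h4 := YoungDiagram.colLen_anti mu 0 c (by omega)
    rw [blockLen, if_neg (by omega), mult_eq]
    omega

theorem blockLen_le {n : ℕ} {mu : YoungDiagram} (hn : len mu ≤ n) (c : ℕ) :
    mu.colLen c + blockLen n mu c ≤ n := by
  have hn : mu.colLen 0 ≤ n := hn
  rcases c with _ | c
  · have h2 : len mu = mu.colLen 0 := rfl
    rw [blockLen, if_pos rfl, h2]
    omega
  · have h3 := YoungDiagram.colLen_anti mu c (c + 1) (by omega)
    have h4 := YoungDiagram.colLen_anti mu 0 c (by omega)
    rw [blockLen, if_neg (by omega), mult_eq]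
    omega

theorem sum_range_eq_sum_blocks {M : Type*} [AddCommMonoid M] {n : ℕ} {mu : YoungDiagram}
    (hn : len mu ≤ n) (f : ℕ → M) : ∑ i ∈ range n, f i =
      ∑ c ∈ range (mu.rowLen 0 + 1),
        ∑ i ∈ Ico (mu.colLen c) (mu.colLen c + blockLen n mu c), f i := by
  rw [← sum_fiberwise_of_maps_to (s := range n) (t := range (mu.rowLen 0 + 1)) (g := mu.rowLen)]
  · refine sum_congr rfl fun c _ => sum_congr ?_ fun _ _ => rfl
    ext i
    rw [mem_block_iff hn, mem_filter, mem_range]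
  · intro i _
    have := YoungDiagram.rowLen_anti mu 0 i (Nat.zero_le i)
    rw [mem_range]
    omega

/-- The boxes lie in consecutive rows r and r + 1, so n(λ) changes by the odd number 2r + 1: hence
the minus sign. For c = 0 the length grows by 2 and the ratio of the `vNum` factors supplies the
product on the right. -/
theorem dominoCoeff_mul_qFactor {t : ℝ} (ht : t ∈ Set.Ioo (-1 : ℝ) 1) {mu lam : YoungDiagram}
    {n c : ℕ} (hn : len mu + 2 ≤ n) (h : AddsDominoAt mu lam (c + 1)) :
    dominoCoeff t mu (c + 1) * qFactor t n lam = qFactor t n mu *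
      -((1 - t ^ blockLen n mu c) * (1 - t ^ (blockLen n mu c - 1))) := by
  have hs : (-1 : ℝ) ^ nStat lam = -(-1) ^ nStat mu := by
    rw [nStat_add_single h.rowLen_eq, pow_add, pow_add, pow_succ]
    have : (-1 : ℝ) ^ mu.colLen c * (-1) ^ mu.colLen c = 1 := by
      rw [← mul_pow]; norm_num
    linear_combination (-(-1 : ℝ) ^ nStat mu) * this
  have hl : len lam = len mu + if 0 = c then 2 else 0 := addsDominoAt_iff.1 h 0
  rw [qFactor, qFactor, hs, hl, dominoCoeff, blockLen]
  rcases c with _ | c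
  · obtain ⟨m, hm⟩ : ∃ m, n = len mu + 2 + m := Nat.exists_eq_add_of_le hn
    rw [if_pos rfl, if_pos rfl, if_pos rfl, show n - (len mu + 2) = m by omega,
      show n - len mu = m + 1 + 1 by omega, vNum_add_one, vNum_add_one, Nat.add_sub_cancel]
    have h1 := vNum_ne_zero ht m
    have h2 := one_sub_pow_ne ht (show 1 ≤ m + 1 by omega)
    have h3 := one_sub_pow_ne ht (show 1 ≤ m + 1 + 1 by omega)
    have h4 : 1 - t ≠ 0 := by simpa using one_sub_pow_ne ht le_rfl
    field_simp
    ring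
  · rw [if_neg (by omega), if_neg (by omega), if_neg (by omega), add_zero, Nat.add_sub_cancel]
    ring

/-- The rows of the two boxes differ by m_{c+1}(μ), so the sign change is (-1)^{m_{c+1}(μ)}, which
turns (-t)^m into t^m. For c = 0 the length grows by 1 and the `vNum` ratio supplies the factor 1 -
t^{n-ℓ(μ)}. -/
theorem pairCoeff_mul_qFactor {t : ℝ} (ht : t ∈ Set.Ioo (-1 : ℝ) 1) {mu lam : YoungDiagram}
    {n c : ℕ} (hn : len mu + 2 ≤ n) (h : AddsPairAt mu lam (c + 1)) :
    pairCoeff t mu (c + 1) * qFactor t n lam = qFactor t n mu *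
      ((1 + t) * (1 - t ^ blockLen n mu c)) * t ^ mult mu (c + 1) := by
  have hs : (-1 : ℝ) ^ nStat lam * (-t) ^ mult mu (c + 1) =
      (-1) ^ nStat mu * t ^ mult mu (c + 1) := by
    have h3 := YoungDiagram.colLen_anti mu c (c + 1) (by omega)
    obtain ⟨d, hd⟩ := Nat.exists_eq_add_of_le h3
    rw [nStat_add_single h.rowLen_eq, mult_eq, hd, Nat.add_sub_cancel_left, neg_pow t, pow_add,
      pow_add, pow_add]
    have h1 : (-1 : ℝ) ^ mu.colLen (c + 1) * (-1) ^ mu.colLen (c + 1) = 1 := by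
      rw [← mul_pow]; norm_num
    have h2 : (-1 : ℝ) ^ d * (-1) ^ d = 1 := by
      rw [← mul_pow]; norm_num
    linear_combination ((-1 : ℝ) ^ nStat mu * t ^ d * (-1) ^ d * (-1) ^ d) * h1 +
      ((-1 : ℝ) ^ nStat mu * t ^ d) * h2
  have hl : len lam = len mu + if 0 = c ∨ 0 = c + 1 then 1 else 0 := addsPairAt_iff.1 h 0
  have hv : (if c + 1 = 1 then 1 else 1 - t ^ mult mu (c + 1 - 1)) *
      ((1 - t) ^ len lam / vNum t (n - len lam)) =
      (1 - t) ^ len mu / vNum t (n - len mu) * (1 - t ^ blockLen n mu c) := by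
    rw [hl, blockLen]
    rcases c with _ | c
    · obtain ⟨m, hm⟩ : ∃ m, n = len mu + 2 + m := Nat.exists_eq_add_of_le hn
      rw [if_pos rfl, if_pos (Or.inl rfl), if_pos rfl, show n - (len mu + 1) = m + 1 by omega,
        show n - len mu = m + 1 + 1 by omega, vNum_add_one t (m + 1)]
      have h1 := vNum_ne_zero ht (m + 1)
      have h3 := one_sub_pow_ne ht (show 1 ≤ m + 1 + 1 by omega)
      have h4 : 1 - t ≠ 0 := by simpa using one_sub_pow_ne ht le_rfl
      field_simp
      ring
    · rw [if_neg (by omega), if_neg (by omega), if_neg (by omega), add_zero, Nat.add_sub_cancel]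
      ring
  rw [qFactor, qFactor, pairCoeff]
  linear_combination (1 + t) * (if c + 1 = 1 then 1 else 1 - t ^ mult mu (c + 1 - 1)) *
      ((1 - t) ^ len lam / vNum t (n - len lam)) * hs +
    (-1) ^ nStat mu * t ^ mult mu (c + 1) * (1 + t) * hv

theorem len_le_of_addsDominoAt {mu lam : YoungDiagram} {c : ℕ} (h : AddsDominoAt mu lam (c + 1)) :
    len lam ≤ len mu + 2 := by
  have hl : len lam = len mu + if 0 = c then 2 else 0 := addsDominoAt_iff.1 h 0
  split_ifs at hl <;> omega

theorem len_le_of_addsPairAt {mu lam : YoungDiagram} {c : ℕ} (h : AddsPairAt mu lam (c + 1)) :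
    len lam ≤ len mu + 2 := by
  have hl : len lam = len mu + if 0 = c ∨ 0 = c + 1 then 1 else 0 := addsPairAt_iff.1 h 0
  split_ifs at hl <;> omega

theorem restrict_dominoTerm {t : ℝ} (ht : t ∈ Set.Ioo (-1 : ℝ) 1) {mu : YoungDiagram}
    {n : ℕ} (hn : len mu + 2 ≤ n) (c : ℕ) :
    vdm n * restrict n (Finsupp.linearCombination ℝ (hlQtilde ht) (dominoTerm t mu (c + 1))) =
      C (qFactor t n mu * -((1 - t ^ blockLen n mu c) * (1 - t ^ (blockLen n mu c - 1)))) *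
        seqAlt t n (mu.rowLen + Pi.single (mu.colLen c) 1 + Pi.single (mu.colLen c + 1) 1) := by
  by_cases h : ∃ lam, AddsDominoAt mu lam (c + 1)
  · obtain ⟨lam, h⟩ := h
    rw [dominoTerm_eq_single h, Finsupp.linearCombination_single, map_smul, smul_eq_C_mul,
      mul_left_comm, vdm_mul_hlQtilde ht ((len_le_of_addsDominoAt h).trans hn), ← mul_assoc,
      ← C_mul, dominoCoeff_mul_qFactor ht hn h, h.rowLen_eq]
  · rw [dominoTerm, dif_neg h, map_zero, map_zero, mul_zero]
    -- When no such diagram exists, the block has at most one row and the scalar on the right is 0.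
    have hc : ¬ (c = 0 ∨ 2 ≤ mult mu c) := fun h' => h (exists_addsDominoAt h')
    rw [not_or] at hc
    rw [blockLen, if_neg hc.1]
    have : mult mu c = 0 ∨ mult mu c = 1 := by omega
    rcases this with h | h <;> simp [h]

theorem restrict_pairTerm {t : ℝ} (ht : t ∈ Set.Ioo (-1 : ℝ) 1) {mu : YoungDiagram}
    {n : ℕ} (hn : len mu + 2 ≤ n) (c : ℕ) :
    vdm n * restrict n (Finsupp.linearCombination ℝ (hlQtilde ht) (pairTerm t mu (c + 1))) =
      C (qFactor t n mu * ((1 + t) * (1 - t ^ blockLen n mu c))) *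
        seqAlt t n (mu.rowLen + Pi.single (mu.colLen c) 1 + Pi.single (mu.colLen c) 1) := by
  by_cases h : ∃ lam, AddsPairAt mu lam (c + 1)
  · obtain ⟨lam, h⟩ := h
    rw [pairTerm_eq_single h, Finsupp.linearCombination_single, map_smul, smul_eq_C_mul,
      mul_left_comm, vdm_mul_hlQtilde ht ((len_le_of_addsPairAt h).trans hn), ← mul_assoc,
      ← C_mul, pairCoeff_mul_qFactor ht hn h, h.rowLen_eq, C_mul, mul_assoc]
    congr 1
    have h0 : mu.colLen 0 + 2 ≤ n := hn
    have h1 := YoungDiagram.colLen_anti mu c (c + 1) (by omega)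
    have h2 := YoungDiagram.colLen_anti mu 0 c (by omega)
    obtain ⟨d, hd⟩ := Nat.exists_eq_add_of_le h1
    -- The right side puts both units in row `mu.colLen c`. The first one makes this row join the
    -- rows of length c + 1 above it; the second then moves to the top of that enlarged block, past
    -- d = m_{c+1}(μ) rows.
    have hm := seqAlt_move_block (t := t) (n := n) (s := mu.colLen (c + 1))
      (b := mu.rowLen + Pi.single (mu.colLen c) 1) d (by omega) ?_
    · rw [← hd] at hm
      rw [mult_eq, hd, Nat.add_sub_cancel_left, ← hd, hm]
    · have hrow : ∀ i, mu.colLen (c + 1) ≤ i → i ≤ mu.colLen (c + 1) + d →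
          (mu.rowLen + Pi.single (mu.colLen c) 1 : ℕ → ℕ) i = c + 1 := by
        intro i hi1 hi2
        rw [← hd] at hi2
        have e1 := lt_colLen_iff (lam := mu) (i := i) (j := c)
        have e2 := lt_colLen_iff (lam := mu) (i := i) (j := c + 1)
        rw [Pi.add_apply, Pi.single_apply]
        split_ifs with hi
        · rcases c with _ | c
          · omega
          · have e3 := lt_colLen_iff (lam := mu) (i := i) (j := c)
            have e4 := h.one_le_mult
            rw [mult_eq] at e4
            omega
        · omega
      intro i hi1 hi2
      rw [hrow i hi1 hi2, hrow _ le_rfl (by omega)]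
  · rw [pairTerm, dif_neg h, map_zero, map_zero, mul_zero]
    have hc : ¬ (c = 0 ∨ 1 ≤ mult mu c) := fun h' => h (exists_addsPairAt h')
    rw [not_or] at hc
    rw [blockLen, if_neg hc.1, show mult mu c = 0 by omega]
    simp

theorem powerSum_two_mul_hlQtilde {t : ℝ} (ht : t ∈ Set.Ioo (-1 : ℝ) 1) (mu : YoungDiagram) :
    ((1 - t ^ 2) • powerSum 2) * hlQtilde ht mu =
      Finsupp.linearCombination ℝ (hlQtilde ht) (xiCoeff t mu) := by
  -- Two more variables than ℓ(μ) suffice for every diagram that occurs.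
  refine eq_of_restrict_eq (m := len mu + 2) fun n hn => ?_
  refine mul_left_cancel₀ (vdm_ne_zero n) ?_
  have hn' : len mu ≤ n := by omega
  have hp : restrict n (powerSum 2) = psum (Fin n) ℝ 2 := rfl
  have h1 : vdm n * restrict n ((1 - t ^ 2) • powerSum 2 * hlQtilde ht mu) =
      C (qFactor t n mu) * (C (1 - t ^ 2) * (psum (Fin n) ℝ 2 * seqAlt t n mu.rowLen)) := by
    rw [map_mul, map_smul, smul_eq_C_mul, hp, mul_left_comm, vdm_mul_hlQtilde ht hn']
    ring
  rw [h1, psum_two_mul_seqAlt, sum_range_eq_sum_blocks hn', mul_sum, mul_sum, xiCoeff, map_sum,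
    map_sum, mul_sum]
  refine sum_congr rfl fun c _ => ?_
  rw [map_add, map_add, mul_add, restrict_dominoTerm ht hn, restrict_pairTerm ht hn,
    sum_seqAlt_block _ (blockLen_le hn' c)]
  · simp only [C_mul, C_neg]
    ring
  · intro i hi1 hi2
    have hi := (mem_block_iff hn').1 (mem_Ico.2 ⟨hi1, hi2⟩)
    -- The block contains i, hence is nonempty and contains its first index.
    have hs := (mem_block_iff hn' (c := c)).1 (mem_Ico.2 ⟨le_rfl, hi1.trans_lt hi2⟩)
    rw [hi.2, hs.2]

end HallLittlewood

theorem theorem8 {t : ℝ} (ht : t ∈ Set.Ioo (-1 : ℝ) 1) (mu : YoungDiagram) :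
    ∃ xi : YoungDiagram →₀ ℝ,
      (∀ c : YoungDiagram →₀ ℝ,
        ((1 - t ^ 2) • powerSum 2) * hlQtilde ht mu = c.sum (fun lam r => r • hlQtilde ht lam) ↔
          c = xi) ∧
      (∀ lam : YoungDiagram, ¬ UpUp mu lam → xi lam = 0) ∧
      (∀ (lam : YoungDiagram) (k : ℕ), AddsDominoAt mu lam k →
        xi lam = if k = 1 then 1
          else (1 - t ^ mult mu (k - 1)) * (1 - t ^ (mult mu (k - 1) - 1))) ∧
      (∀ (lam : YoungDiagram) (k : ℕ), AddsPairAt mu lam k →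
        xi lam = (-t) ^ mult mu k * (1 + t) *
          (if k = 1 then 1 else 1 - t ^ mult mu (k - 1))) ∧
      (t < 0 → ∀ lam : YoungDiagram, UpUp mu lam → 0 < xi lam) := by
  refine ⟨xiCoeff t mu, fun c => ?_, fun _ => xiCoeff_of_not_upUp,
    fun _ _ => xiCoeff_of_addsDominoAt, fun _ _ => xiCoeff_of_addsPairAt,
    fun ht0 _ => xiCoeff_pos ht ht0⟩
  rw [powerSum_two_mul_hlQtilde, ← Finsupp.linearCombination_apply,
    (hlQtilde_linearIndependent ht).finsuppLinearCombination_injective.eq_iff, eq_comm]
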